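/- All random variables take values in finite sets. For a pair $(X,Y)$ with joint distribution $P_{XY}$ and $\alpha\in(1,\infty)$, the $\alpha$-leakage is $$\mathcal L_\alpha(X\to Y)=\frac{\alpha}{\alpha-1}\log\frac{\max_{P_{\hat X|Y}}\sum_{x,y}P_{XY}(x,y)\,P_{\hat X|Y}(x|y)^{\frac{\alpha-1}{\alpha}}}{\max_{P_{\hat X}}\sum_{x}P_X(x)\,P_{\hat X}(x)^{\frac{\alpha-1}{\alpha}}},$$ extended continuously to $\alpha=1$ and $\alpha=\infty$. For $\alpha\in[1,\infty]$ the maximal $\alpha$-leakage is $\mathcal L^{\max}_\alpha(X\to Y)=\sup_{U-X-Y}\mathcal L_\alpha(U\to Y)$, the supremum being over all Markov chains $U-X-Y$ with $U$ on an arbitrary finite alphabet. The Sibson mutual information of order $\alpha\in(0,1)\cup(1,\infty)$ is $I^{S}_\alpha(P_X,P_{Y|X})=\inf_{Q_Y}D_\alpha(P_{XY}\,\|\,P_X\times Q_Y)$, with $D_\alpha$ the Rényi divergence, extended continuously to $\alpha=1$ and $\alpha=\infty$; $H$ is the Shannon entropy. Let $\mathcal X,\mathcal Y$ be the alphabets of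 $X,Y$. **Theorem 3.** For every $\alpha\in[1,\infty]$: 1. For fixed $P_X$, $\mathcal L^{\max}_\alpha(X\to Y)$ is quasi-convex in $P_{Y|X}$. 2. $\mathcal L^{\max}_\alpha(X\to Y)\le\mathcal L^{\max}_\beta(X\to Y)$ for every $\beta\in[\alpha,\infty]$. 3. If $X-Y-Z$ is a Markov chain, then $\mathcal L^{\max}_\alpha(X\to Z)\le\mathcal L^{\max}_\alpha(X\to Y)$ and $\mathcal L^{\max}_\alpha(X\to Z)\le\mathcal L^{\max}_\alpha(Y\to Z)$. 4. $\mathcal L^{\max}_\alpha(X\to Y)\ge 0$, with equality if and only if $X$ and $Y$ are independent. Moreover $\mathcal L^{\max}_\alpha(X\to Y)\le\log|\mathcal X|$ if $\alpha>1$ and $\mathcal L^{\max}_1(X\to Y)\le H(P_X)$; if $X$ is a deterministic function of $Y$ and $P_X(x)>0$ for all $x\in\mathcal X$, equality holds in both cases. 5. $\mathcal L^{\max}_\alpha(X\to Y)\le I^{S}_\infty(P_X,P_{Y|X})$, with equality if $\mathcal L^{\max}_\alpha(X\to Y)$ is $0$ or $\log|\mathcal X|$. 6. Suppose $P_X(x)>0$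 for all $x\in\mathcal X$, and let $P^{(u)}_X$ be the uniform distribution on $\mathcal X$. If $\alpha>1$, then $\mathcal L^{\max}_\alpha(X\to Y)\ge I^{S}_\alpha(P^{(u)}_X,P_{Y|X})$, where for $\alpha\in(1,\infty)$ $$I^{S}_\alpha(P^{(u)}_X,P_{Y|X})=\frac{\alpha}{\alpha-1}\log\frac{\sum_{y\in\mathcal Y}\bigl(\sum_{x\in\mathcal X}P_{Y|X}(y|x)^\alpha\bigr)^{1/\alpha}}{|\mathcal X|^{1/\alpha}};$$ equality holds if $P_{Y|X}$ is symmetric (all its rows are permutations of each other, and so are all its columns). For every $\alpha\in[1,\infty]$, $\mathcal L^{\max}_\alpha(X\to Y)=I^{S}_\alpha(P^{(u)}_X,P_{Y|X})$ if $\mathcal L^{\max}_\alpha(X\to Y)=0$. -/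

import Mathlib

open scoped ENNReal Topology
open Filter

namespace MaxAlphaLeakage

noncomputable section

/-- First marginal of a joint law on `A × B`. -/
def margFst {A B : Type*} [Fintype B] (P : A × B → ℝ) (a : A) : ℝ := ∑ b, P (a, b)

/-- Second marginal of a joint law on `A × B`. -/
def margSnd {A B : Type*} [Fintype A] (P : A × B → ℝ) (b : B) : ℝ := ∑ a, P (a, b)

/-- The channels (conditional distributions, row-stochastic matrices) from `A` to `B`. -/
def channels (A B : Type*) [Fintype B] : Set (A → B → ℝ) :=
  {W | ∀ a, W a ∈ stdSimplex ℝ B}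

/-- The joint law with first marginal `p` and conditional distribution `W`. -/
def jointLaw {A B : Type*} (p : A → ℝ) (W : A → B → ℝ) : A × B → ℝ :=
  fun z => p z.1 * W z.1 z.2

/-- The uniform distribution on a finite type. -/
def uniformLaw (A : Type*) [Fintype A] : A → ℝ := fun _ => 1 / (Fintype.card A : ℝ)

/-- The two components of a joint law are independent. -/
def IsIndep {A B : Type*} [Fintype A] [Fintype B] (P : A × B → ℝ) : Prop :=
  ∀ a b, P (a, b) = margFst P a * margSnd P b

/-- Under the joint law `P`, the first component is a deterministic function of the second. -/
def IsFunctionOfSnd {A B : Type*} (P : A × B → ℝ) : Prop :=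
  ∃ g : B → A, ∀ a b, P (a, b) ≠ 0 → a = g b

/-- The three components of a joint law form a Markov chain `A - B - C`:
`P(a,b,c) P(b) = P(a,b) P(b,c)`. -/
def IsMarkovChain {A B C : Type*} [Fintype A] [Fintype C] (Q : A × B × C → ℝ) : Prop :=
  ∀ a b c, Q (a, b, c) * (∑ a', ∑ c', Q (a', b, c'))
    = (∑ c', Q (a, b, c')) * (∑ a', Q (a', b, c))

/-- A channel is symmetric: its rows are permutations of each other, and so are its columns. -/
def IsSymmetricChannel {A B : Type*} (W : A → B → ℝ) : Prop :=
  (∀ a a', ∃ σ : Equiv.Perm B, ∀ b, W a' b = W a (σ b)) ∧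
  (∀ b b', ∃ τ : Equiv.Perm A, ∀ a, W a b' = W (τ a) b)

/-- Shannon entropy. -/
def shannonEntropy {A : Type*} [Fintype A] (p : A → ℝ) : ℝ := ∑ a, Real.negMulLog (p a)

/-- Rényi divergence of order `a ∈ (0,1) ∪ (1,∞)`. The arithmetic of `ℝ≥0∞` provides the usual
conventions (a term with `P i = 0` vanishes, and for `a > 1` a term with `Q i = 0 < P i` is `∞`). -/
def renyiDiv {ι : Type*} [Fintype ι] (a : ℝ) (P Q : ι → ℝ) : EReal :=
  (((a - 1)⁻¹ : ℝ) : EReal) *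
    ENNReal.log (∑ i, ENNReal.ofReal (P i) ^ a * ENNReal.ofReal (Q i) ^ (1 - a))

/-- Sibson mutual information of order `a ∈ (0,1) ∪ (1,∞)`:
`inf_{Q_B} D_a(P_{AB} ‖ P_A × Q_B)`. -/
def sibsonMIReal {A B : Type*} [Fintype A] [Fintype B] (a : ℝ) (P : A × B → ℝ) : EReal :=
  ⨅ q ∈ stdSimplex ℝ B, renyiDiv a P (fun z => margFst P z.1 * q z.2)

/-- Sibson mutual information of order `α ∈ (0,∞]`; the orders `1` and `∞` are
the continuous extension. -/
def sibsonMI {A B : Type*} [Fintype A] [Fintype B] (α : ℝ≥0∞) (P : A × B → ℝ) : EReal :=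
  if α = 1 then limUnder (𝓝[≠] (1 : ℝ)) (fun a : ℝ => sibsonMIReal a P)
  else if α = ∞ then limUnder atTop (fun a : ℝ => sibsonMIReal a P)
  else sibsonMIReal α.toReal P

/-- `max over P_{Â|B} of E[ P(Â = A | A, B)^((a-1)/a) ]` -/
def gainWith {A B : Type*} [Fintype A] [Fintype B] (a : ℝ) (P : A × B → ℝ) : ℝ :=
  sSup ((fun S : B → A → ℝ => ∑ x, ∑ y, P (x, y) * S y x ^ ((a - 1) / a)) '' channels B A)

/-- `max over P_Â of E[ P(Â = A | A)^((a-1)/a) ]` -/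
def gainWithout {A : Type*} [Fintype A] (a : ℝ) (p : A → ℝ) : ℝ :=
  sSup ((fun s : A → ℝ => ∑ x, p x * s x ^ ((a - 1) / a)) '' stdSimplex ℝ A)

/-- The `a`-leakage from the first to the second component, for `a ∈ (1,∞)`. -/
def leakageReal {A B : Type*} [Fintype A] [Fintype B] (a : ℝ) (P : A × B → ℝ) : ℝ :=
  a / (a - 1) * Real.log (gainWith a P / gainWithout a (margFst P))

/-- The `α`-leakage from the first to the second component, for `α ∈ [1,∞]`; the orders `1`
and `∞` are the continuous extension from `(1,∞)`. -/
def leakage {A B : Type*} [Fintype A] [Fintype B] (α : ℝ≥0∞) (P : A × B → ℝ) : ℝ :=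
  if α = 1 then limUnder (𝓝[>] (1 : ℝ)) (fun a : ℝ => leakageReal a P)
  else if α = ∞ then limUnder atTop (fun a : ℝ => leakageReal a P)
  else leakageReal α.toReal P

/-- The maximal `α`-leakage from `A` to `B` under the joint law `P`: the supremum of the
`α`-leakage from `U` to `B` over all Markov chains `U - A - B` with `(A, B) ∼ P` and `U` on a
finite alphabet (up to relabelling, `Fin n`). -/
def maxLeakage {A B : Type*} [Fintype A] [Fintype B] (α : ℝ≥0∞) (P : A × B → ℝ) : EReal :=
  ⨆ (n : ℕ) (Q : Fin n × A × B → ℝ)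
    (_ : Q ∈ stdSimplex ℝ (Fin n × A × B) ∧ IsMarkovChain Q ∧ ∀ x y, ∑ u, Q (u, x, y) = P (x, y)),
    ((leakage α (fun z : Fin n × B => ∑ x, Q (z.1, x, z.2)) : ℝ) : EReal)

end

end MaxAlphaLeakage

open MaxAlphaLeakage

/-!
For `1 < a < ∞`, Hölder's inequality with its equality case solves both optimization problems in
the leakage, which becomes
`a / (a - 1) * log (∑ y, ‖P(·, y)‖_a / ‖P_X‖_a)` (`leakageReal_eq`). From this closed form the
limits `a → 1` (the mutual information) and `a → ∞` are computed. Each order `α ∈ [1, ∞]` comes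
with a filter on `(1, ∞)`, `orderFilter α`, along which the leakages converge to that of order `α`,
so that inequalities have to be proved for `1 < a < ∞` only. A Markov chain `U - X - Y` is given by
the joint law `q` of `(U, X)`, a nonnegative matrix with column sums `p`, and the law of `(U, Y)` is
the matrix product of `q` and the channel `W`. Quasi-convexity in `W` and both data processing
inequalities are then instances of Minkowski's inequality.

The other parts rest on the identity between the maximal leakage of order `a` and the supremum of
the Sibson mutual information `F_a(p') = a / (a - 1) * log (∑ y, (∑ x, p' x * W x y ^ a) ^ (1 / a))`
over the input laws `p'` with the same support as `p`.

* Every leakage is at most some `F_a(p')`: Jensen's inequality for the conditional law of `X` given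
  `U` (`exists_leakageReal_compose_le_sibsonForm`).
* Every `F_a(p')` is a leakage: each letter `x` is shattered into pieces whose probabilities `v`
  have a sum `∑ v ^ a` proportional to `p' x` (`exists_leakageReal_eq_sibsonForm`). For `a = ∞`, the
  largest pieces of all letters are made equally likely (`exists_leakage_top_eq_sibsonFormTop`).
* `F_a` is nondecreasing in `a`, by interpolation of the columns of `W` between `L^1` and `L^b` and
  Hölder's inequality for the sum over the columns (`sibsonForm_mono`). It tends to
  `log (∑ y, max W(·, y))`, the maximum being over the support of `p`, as `a → ∞`.
* `F_a(p)` is the infimum of Rényi divergences that defines the Sibson mutual information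
  (`sibsonMIReal_jointLaw`).

Monotonicity in the order and the bounds in terms of the Sibson mutual information follow. A
vanishing maximal leakage forces `I(X; Y) = 0` by monotonicity, hence independence by the equality
case of Gibbs' inequality. At the order `1`, data processing gives `I(U; Y) ≤ I(U; X) ≤ H(X)`. For a
symmetric channel, concavity of `t ^ (1 / a)` shows that the uniform law maximizes `F_a`.
-/

namespace MaxAlphaLeakage

/-! ### Norms of nonnegative vectors and the closed form of the leakage -/

noncomputable section

/-- The `ℓ^a` norm of a nonnegative vector. -/
def powNorm {A : Type*} [Fintype A] (a : ℝ) (f : A → ℝ) : ℝ := (∑ x, f x ^ a) ^ (1 / a)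

section Norm

variable {A B : Type*} [Fintype A] [Fintype B] {a : ℝ}

lemma sum_rpow_nonneg {f : A → ℝ} (hf : ∀ x, 0 ≤ f x) : 0 ≤ ∑ x, f x ^ a :=
  Finset.sum_nonneg fun x _ => Real.rpow_nonneg (hf x) a

lemma powNorm_nonneg {f : A → ℝ} (hf : ∀ x, 0 ≤ f x) : 0 ≤ powNorm a f :=
  Real.rpow_nonneg (sum_rpow_nonneg hf) _

lemma powNorm_pos {f : A → ℝ} (hf : ∀ x, 0 ≤ f x) {x : A} (hx : 0 < f x) : 0 < powNorm a f :=
  Real.rpow_pos_of_pos (lt_of_lt_of_le (Real.rpow_pos_of_pos hx a)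
    (Finset.single_le_sum (f := fun x => f x ^ a) (fun x _ => Real.rpow_nonneg (hf x) a)
      (Finset.mem_univ x))) _

lemma powNorm_zero (ha : 0 < a) : powNorm a (fun _ : A => (0 : ℝ)) = 0 := by
  simp [powNorm, Real.zero_rpow ha.ne', Real.zero_rpow (inv_pos.2 ha).ne']

lemma powNorm_const_mul (ha : 0 < a) {c : ℝ} (hc : 0 ≤ c) {f : A → ℝ} (hf : ∀ x, 0 ≤ f x) :
    powNorm a (fun x => c * f x) = c * powNorm a f := by
  unfold powNorm
  simp_rw [Real.mul_rpow hc (hf _), ← Finset.mul_sum]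
  rw [Real.mul_rpow (Real.rpow_nonneg hc _) (sum_rpow_nonneg hf), ← Real.rpow_mul hc,
    mul_one_div_cancel ha.ne', Real.rpow_one]

lemma powNorm_sum_le {ι : Type*} (ha : 1 ≤ a) (f : ι → A → ℝ) (hf : ∀ y x, 0 ≤ f y x)
    (s : Finset ι) :
    powNorm a (fun x => ∑ y ∈ s, f y x) ≤ ∑ y ∈ s, powNorm a (f y) := by
  classical
  induction s using Finset.induction_on with
  | empty => simp [powNorm_zero (A := A) (zero_lt_one.trans_le ha)]
  | insert y s hy ih =>
    simp only [Finset.sum_insert hy]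
    refine le_trans ?_ (add_le_add_right ih _)
    exact Real.Lp_add_le_of_nonneg Finset.univ ha (fun x _ => hf y x)
      (fun x _ => Finset.sum_nonneg fun z _ => hf z x)

lemma powNorm_equiv (e : A ≃ B) (f : B → ℝ) : powNorm a (fun x => f (e x)) = powNorm a f := by
  unfold powNorm
  rw [Equiv.sum_comp e (fun x => f x ^ a)]

lemma nonempty_of_mem_stdSimplex {p : A → ℝ} (hp : p ∈ stdSimplex ℝ A) : Nonempty A := by
  by_contra h
  rw [not_nonempty_iff] at h
  simpa using hp.2

lemma sum_mul_rpow_le_powNorm (ha : 1 < a) {p s : A → ℝ} (hp : ∀ x, 0 ≤ p x)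
    (hs : s ∈ stdSimplex ℝ A) : ∑ x, p x * s x ^ ((a - 1) / a) ≤ powNorm a p := by
  have h := Real.inner_le_Lp_mul_Lq_of_nonneg (s := Finset.univ) (f := p)
    (g := fun x => s x ^ ((a - 1) / a)) (Real.HolderConjugate.conjExponent ha)
    (fun x _ => hp x) (fun x _ => Real.rpow_nonneg (hs.1 x) _)
  have h1 : ∀ x, (s x ^ ((a - 1) / a)) ^ (Real.conjExponent a) = s x := fun x => by
    rw [← Real.rpow_mul (hs.1 x), Real.conjExponent, div_mul_div_cancel₀ (by linarith),
      div_self (by linarith), Real.rpow_one]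
  simp only [h1, hs.2, Real.one_rpow, mul_one] at h
  exact h

/-- Equality in Hölder's inequality holds for `s` proportional to `p ^ a`. -/
lemma exists_sum_mul_rpow_eq_powNorm [Nonempty A] (ha : 1 < a) {p : A → ℝ} (hp : ∀ x, 0 ≤ p x) :
    ∃ s ∈ stdSimplex ℝ A, ∑ x, p x * s x ^ ((a - 1) / a) = powNorm a p := by
  have ha0 : 0 < a := by linarith
  rcases (sum_rpow_nonneg (a := a) hp).eq_or_lt with h0 | h0
  · have hz : ∀ x, p x = 0 := fun x => by
      have := (Finset.sum_eq_zero_iff_of_nonneg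
        (fun x _ => Real.rpow_nonneg (hp x) a)).1 h0.symm x (Finset.mem_univ x)
      exact ((Real.rpow_eq_zero (hp x) ha0.ne').1 this)
    obtain ⟨x₀⟩ := ‹Nonempty A›
    classical
    refine ⟨Pi.single x₀ 1, single_mem_stdSimplex ℝ x₀, ?_⟩
    rw [show p = fun _ => 0 from funext hz, powNorm_zero ha0]
    simp
  · set T := ∑ x, p x ^ a with hT
    refine ⟨fun x => p x ^ a / T, ⟨fun x => div_nonneg (Real.rpow_nonneg (hp x) a) h0.le, ?_⟩, ?_⟩
    · rw [← Finset.sum_div, div_self h0.ne']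
    · have h1 : ∀ x, p x * (p x ^ a / T) ^ ((a - 1) / a) = p x ^ a / T ^ ((a - 1) / a) := by
        intro x
        rw [Real.div_rpow (Real.rpow_nonneg (hp x) a) h0.le, ← Real.rpow_mul (hp x),
          mul_div_cancel₀ _ ha0.ne', ← mul_div_assoc]
        congr 1
        rw [← Real.rpow_one_add' (hp x) (by linarith)]
        ring_nf
      simp only [h1]
      rw [← Finset.sum_div, powNorm, ← hT]
      rw [div_eq_iff (Real.rpow_pos_of_pos h0 _).ne', ← Real.rpow_add h0]
      rw [show 1 / a + (a - 1) / a = 1 by field_simp; ring, Real.rpow_one]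

lemma gainWithout_eq [Nonempty A] (ha : 1 < a) {p : A → ℝ} (hp : ∀ x, 0 ≤ p x) :
    gainWithout a p = powNorm a p := by
  obtain ⟨s, hs, he⟩ := exists_sum_mul_rpow_eq_powNorm ha hp
  refine IsGreatest.csSup_eq ⟨⟨s, hs, he⟩, ?_⟩
  rintro _ ⟨t, ht, rfl⟩
  exact sum_mul_rpow_le_powNorm ha hp ht

lemma gainWith_eq [Nonempty A] (ha : 1 < a) {P : A × B → ℝ} (hP : ∀ z, 0 ≤ P z) :
    gainWith a P = ∑ y, powNorm a (fun x => P (x, y)) := by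
  choose S hS he using fun y : B =>
    exists_sum_mul_rpow_eq_powNorm (p := fun x => P (x, y)) ha (fun x => hP _)
  refine IsGreatest.csSup_eq ⟨⟨S, hS, ?_⟩, ?_⟩
  · dsimp only
    rw [Finset.sum_comm]
    exact Finset.sum_congr rfl fun y _ => he y
  · rintro _ ⟨T, hT, rfl⟩
    dsimp only
    rw [Finset.sum_comm]
    exact Finset.sum_le_sum fun y _ => sum_mul_rpow_le_powNorm ha (fun x => hP _) (hT y)

/-- The `a`-leakage is the Arimoto mutual information of order `a`. -/
lemma leakageReal_eq [Nonempty A] (ha : 1 < a) {P : A × B → ℝ} (hP : ∀ z, 0 ≤ P z) :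
    leakageReal a P = a / (a - 1) *
      Real.log ((∑ y, powNorm a (fun x => P (x, y))) / powNorm a (margFst P)) := by
  rw [leakageReal, gainWith_eq ha hP,
    gainWithout_eq (p := margFst P) ha (fun x => Finset.sum_nonneg fun y _ => hP _)]

end Norm

end

/-! ### The limiting orders -/

noncomputable section

/-- The `L^a` norm of a nonnegative function under the nonnegative weights `w`. -/
def wNorm {A : Type*} [Fintype A] (a : ℝ) (w f : A → ℝ) : ℝ := (∑ x, w x * f x ^ a) ^ (1 / a)

/-- The maximum of a nonnegative function over the support of the nonnegative weights `w`
(zero if `w = 0`). -/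
def supOn {A : Type*} [Fintype A] (w f : A → ℝ) : ℝ := ⨆ x, if 0 < w x then f x else 0

/-- Mutual information, as `H(A) + H(B) - H(A, B)`. -/
def mutualInfo {A B : Type*} [Fintype A] [Fintype B] (P : A × B → ℝ) : ℝ :=
  shannonEntropy (margFst P) + shannonEntropy (margSnd P) - shannonEntropy P

section Limits

variable {A B : Type*} [Fintype A] [Fintype B] {a : ℝ}

lemma powNorm_eq_wNorm (a : ℝ) (f : A → ℝ) : powNorm a f = wNorm a (fun _ => 1) f := by
  simp [powNorm, wNorm]

lemma le_supOn (w f : A → ℝ) {x : A} (hx : 0 < w x) : f x ≤ supOn w f := by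
  have := le_ciSup (f := fun x => if 0 < w x then f x else 0)
    (Set.finite_range _).bddAbove x
  simpa [supOn, hx] using this

lemma supOn_nonneg {w f : A → ℝ} (hf : ∀ x, 0 ≤ f x) : 0 ≤ supOn w f :=
  Real.iSup_nonneg fun x => by split_ifs <;> simp [hf x]

lemma supOn_le {w f : A → ℝ} {c : ℝ} (hc : 0 ≤ c) (h : ∀ x, 0 < w x → f x ≤ c) :
    supOn w f ≤ c :=
  Real.iSup_le (fun x => by split_ifs with hx; exacts [h x hx, hc]) hc

/-- A positive maximum over the support is attained. -/
lemma exists_eq_supOn {w f : A → ℝ} (h : 0 < supOn w f) : ∃ x, 0 < w x ∧ f x = supOn w f := by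
  have : Nonempty A := by
    by_contra hA
    rw [not_nonempty_iff] at hA
    simp [supOn] at h
  obtain ⟨x, hx⟩ := exists_eq_ciSup_of_finite (f := fun x => if 0 < w x then f x else 0)
  change _ = supOn w f at hx
  by_cases hw : 0 < w x
  · exact ⟨x, hw, by simpa [hw] using hx⟩
  · simp only [hw, if_false] at hx
    exact absurd hx h.ne

lemma wNorm_nonneg {w f : A → ℝ} (hw : ∀ x, 0 ≤ w x) (hf : ∀ x, 0 ≤ f x) : 0 ≤ wNorm a w f :=
  Real.rpow_nonneg (Finset.sum_nonneg fun x _ => mul_nonneg (hw x) (Real.rpow_nonneg (hf x) a)) _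

lemma tendsto_rpow_one_div_atTop {c : ℝ} (hc : 0 < c) :
    Tendsto (fun a : ℝ => c ^ (1 / a)) atTop (𝓝 1) := by
  have h : Tendsto (fun a : ℝ => 1 / a) atTop (𝓝 0) := by
    simpa using tendsto_inv_atTop_zero (𝕜 := ℝ)
  have h2 := (Real.continuousAt_const_rpow (b := (0 : ℝ)) hc.ne').tendsto.comp h
  rwa [Real.rpow_zero] at h2

/-- `L^a` norms converge to the maximum over the support as `a → ∞`. -/
lemma tendsto_wNorm_atTop {w f : A → ℝ} (hw : ∀ x, 0 ≤ w x) (hf : ∀ x, 0 ≤ f x) :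
    Tendsto (fun a => wNorm a w f) atTop (𝓝 (supOn w f)) := by
  rcases (supOn_nonneg (w := w) hf).eq_or_lt with h0 | h0
  · rw [← h0]
    refine tendsto_const_nhds.congr' ?_
    filter_upwards [eventually_gt_atTop 0] with a ha
    have : ∀ x, w x * f x ^ a = 0 := fun x => by
      rcases (hw x).eq_or_lt with hx | hx
      · simp [← hx]
      · have : f x = 0 := le_antisymm (h0 ▸ le_supOn w f hx) (hf x)
        simp [this, Real.zero_rpow ha.ne']
    simp [wNorm, this, Real.zero_rpow (inv_pos.2 ha).ne']
  · obtain ⟨x₀, hx₀, hM⟩ := exists_eq_supOn h0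
    set M := supOn w f
    have hS : 0 < ∑ x, w x := lt_of_lt_of_le hx₀
      (Finset.single_le_sum (fun x _ => hw x) (Finset.mem_univ x₀))
    have lim : ∀ c : ℝ, 0 < c → Tendsto (fun a : ℝ => c ^ (1 / a) * M) atTop (𝓝 M) :=
      fun c hc => by simpa using (tendsto_rpow_one_div_atTop hc).mul_const M
    have hpow : ∀ a : ℝ, 0 < a → ∀ c, 0 < c → c ^ (1 / a) * M = (c * M ^ a) ^ (1 / a) := by
      intro a ha c hc
      rw [Real.mul_rpow hc.le (Real.rpow_nonneg h0.le _), ← Real.rpow_mul h0.le,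
        mul_one_div_cancel ha.ne', Real.rpow_one]
    refine tendsto_of_tendsto_of_tendsto_of_le_of_le' (lim _ hx₀) (lim _ hS) ?_ ?_
    · filter_upwards [eventually_gt_atTop 0] with a ha
      rw [hpow a ha _ hx₀]
      refine Real.rpow_le_rpow (mul_nonneg hx₀.le (Real.rpow_nonneg h0.le _)) ?_ (by positivity)
      rw [← hM]
      exact Finset.single_le_sum (f := fun x => w x * f x ^ a)
        (fun x _ => mul_nonneg (hw x) (Real.rpow_nonneg (hf x) a)) (Finset.mem_univ x₀)
    · filter_upwards [eventually_gt_atTop 0] with a ha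
      rw [hpow a ha _ hS]
      refine Real.rpow_le_rpow (Finset.sum_nonneg fun x _ =>
        mul_nonneg (hw x) (Real.rpow_nonneg (hf x) a)) ?_ (by positivity)
      rw [Finset.sum_mul]
      refine Finset.sum_le_sum fun x _ => ?_
      rcases (hw x).eq_or_lt with hx | hx
      · simp [← hx]
      · exact mul_le_mul_of_nonneg_left
          (Real.rpow_le_rpow (hf x) (le_supOn w f hx) ha.le) hx.le

lemma tendsto_div_sub_one_atTop : Tendsto (fun a : ℝ => a / (a - 1)) atTop (𝓝 1) := by
  have h : Tendsto (fun a : ℝ => 1 + (a - 1)⁻¹) atTop (𝓝 (1 + 0)) :=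
    tendsto_const_nhds.add
      (tendsto_inv_atTop_zero.comp (tendsto_atTop_add_const_right _ (-1) tendsto_id))
  rw [add_zero] at h
  refine h.congr' ?_
  filter_upwards [eventually_gt_atTop 1] with a ha
  have : a - 1 ≠ 0 := by linarith
  field_simp
  ring

lemma margFst_mem {P : A × B → ℝ} (hP : P ∈ stdSimplex ℝ (A × B)) :
    margFst P ∈ stdSimplex ℝ A :=
  ⟨fun _ => Finset.sum_nonneg fun _ _ => hP.1 _, by
    rw [← hP.2, Fintype.sum_prod_type]; rfl⟩

lemma margSnd_mem {P : A × B → ℝ} (hP : P ∈ stdSimplex ℝ (A × B)) :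
    margSnd P ∈ stdSimplex ℝ B :=
  ⟨fun _ => Finset.sum_nonneg fun _ _ => hP.1 _, by
    rw [← hP.2, Fintype.sum_prod_type_right]; rfl⟩

lemma exists_pos_of_mem_stdSimplex {p : A → ℝ} (hp : p ∈ stdSimplex ℝ A) : ∃ x, 0 < p x := by
  by_contra! h
  have : ∑ x, p x ≤ 0 := Finset.sum_nonpos fun x _ => h x
  linarith [hp.2]

lemma nonempty_fst_of_mem {P : A × B → ℝ} (hP : P ∈ stdSimplex ℝ (A × B)) : Nonempty A :=
  (nonempty_of_mem_stdSimplex hP).map Prod.fst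

lemma powNorm_margFst_pos {P : A × B → ℝ} (hP : P ∈ stdSimplex ℝ (A × B)) :
    0 < powNorm a (margFst P) := by
  obtain ⟨x, hx⟩ := exists_pos_of_mem_stdSimplex (margFst_mem hP)
  exact powNorm_pos (margFst_mem hP).1 hx

lemma sum_powNorm_pos {P : A × B → ℝ} (hP : P ∈ stdSimplex ℝ (A × B)) :
    0 < ∑ y, powNorm a (fun x => P (x, y)) := by
  obtain ⟨z, hz⟩ := exists_pos_of_mem_stdSimplex hP
  exact Finset.sum_pos' (fun y _ => powNorm_nonneg fun x => hP.1 _)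
    ⟨z.2, Finset.mem_univ _, powNorm_pos (fun x => hP.1 _) (x := z.1) hz⟩

/-- As `a → ∞` the leakage tends to the logarithm of the ratio of the probabilities of guessing
the first component correctly with and without observing the second one. -/
lemma tendsto_leakageReal_atTop {P : A × B → ℝ} (hP : P ∈ stdSimplex ℝ (A × B)) :
    Tendsto (fun a => leakageReal a P) atTop (𝓝 (Real.log
      ((∑ y, supOn (fun _ => 1) (fun x => P (x, y))) / supOn (fun _ => 1) (margFst P)))) := by
  have hA := nonempty_fst_of_mem hP
  have hM : 0 < supOn (fun _ => 1) (margFst P) := by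
    obtain ⟨x, hx⟩ := exists_pos_of_mem_stdSimplex (margFst_mem hP)
    exact hx.trans_le (le_supOn _ _ one_pos)
  have hS : 0 < ∑ y, supOn (fun _ => 1) (fun x => P (x, y)) := by
    obtain ⟨z, hz⟩ := exists_pos_of_mem_stdSimplex hP
    exact Finset.sum_pos' (fun y _ => supOn_nonneg fun x => hP.1 _)
      ⟨z.2, Finset.mem_univ _,
        lt_of_lt_of_le hz (le_supOn (fun _ => 1) (fun x => P (x, z.2)) (x := z.1) one_pos)⟩
  have h1 : Tendsto (fun a => (∑ y, powNorm a (fun x => P (x, y))) / powNorm a (margFst P)) atTop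
      (𝓝 ((∑ y, supOn (fun _ => 1) (fun x => P (x, y))) / supOn (fun _ => 1) (margFst P))) := by
    simp only [powNorm_eq_wNorm]
    exact (tendsto_finsetSum _ fun y _ => tendsto_wNorm_atTop (fun _ => zero_le_one)
      fun x => hP.1 _).div (tendsto_wNorm_atTop (fun _ => zero_le_one) (margFst_mem hP).1) hM.ne'
  have h2 := tendsto_div_sub_one_atTop.mul (h1.log (div_pos hS hM).ne')
  rw [one_mul] at h2
  refine h2.congr' ?_
  filter_upwards [eventually_gt_atTop 1] with a ha
  rw [leakageReal_eq ha hP.1]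

lemma hasDerivAt_powNorm_one {f : A → ℝ} (hf : ∀ x, 0 ≤ f x) :
    HasDerivAt (fun a => powNorm a f) (Real.negMulLog (∑ x, f x) - shannonEntropy f) 1 := by
  have hd : ∀ x, HasDerivAt (fun a : ℝ => f x ^ a) (-Real.negMulLog (f x)) 1 := fun x => by
    rcases (hf x).eq_or_lt with h | h
    · rw [← h, Real.negMulLog_zero, neg_zero]
      refine (hasDerivAt_const (1 : ℝ) (0 : ℝ)).congr_of_eventuallyEq ?_
      filter_upwards [eventually_gt_nhds (zero_lt_one' ℝ)] with a ha
      exact Real.zero_rpow ha.ne'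
    · refine (Real.hasStrictDerivAt_const_rpow h 1).hasDerivAt.congr_deriv ?_
      simp [Real.negMulLog]
  have hS : HasDerivAt (fun a : ℝ => ∑ x, f x ^ a) (-shannonEntropy f) 1 := by
    refine (HasDerivAt.fun_sum (u := Finset.univ) fun x _ => hd x).congr_deriv ?_
    simp [shannonEntropy]
  rcases (Finset.sum_nonneg fun x (_ : x ∈ Finset.univ) => hf x).eq_or_lt with h | h
  · have hz : f = fun _ => 0 := funext fun x =>
      (Finset.sum_eq_zero_iff_of_nonneg (fun x _ => hf x)).1 h.symm x (Finset.mem_univ x)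
    rw [hz]
    simp only [shannonEntropy, Finset.sum_const_zero, Real.negMulLog_zero, sub_zero]
    refine (hasDerivAt_const (1 : ℝ) (0 : ℝ)).congr_of_eventuallyEq ?_
    filter_upwards [eventually_gt_nhds (zero_lt_one' ℝ)] with a ha
    exact powNorm_zero ha
  · have hinv : HasDerivAt (fun a : ℝ => 1 / a) (-1) 1 := by
      simpa using hasDerivAt_inv (one_ne_zero (α := ℝ))
    refine (hS.rpow hinv (by simpa using h)).congr_deriv ?_
    simp [Real.negMulLog]
    ring

/-- As `a → 1` the leakage tends to the mutual information: both the numerator and the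
denominator in its closed form equal `1` at `a = 1`, so the limit is the difference of their
derivatives. -/
lemma tendsto_leakageReal_one {P : A × B → ℝ} (hP : P ∈ stdSimplex ℝ (A × B)) :
    Tendsto (fun a => leakageReal a P) (𝓝[>] 1) (𝓝 (mutualInfo P)) := by
  have hA := nonempty_fst_of_mem hP
  have hG : HasDerivAt (fun a => ∑ y, powNorm a (fun x => P (x, y)))
      (shannonEntropy (margSnd P) - shannonEntropy P) 1 := by
    refine (HasDerivAt.fun_sum (u := Finset.univ) fun y _ =>
      hasDerivAt_powNorm_one (f := fun x => P (x, y)) (fun x => hP.1 _)).congr_deriv ?_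
    simp only [Finset.sum_sub_distrib, shannonEntropy, margSnd]
    rw [Fintype.sum_prod_type_right]
  have hH := hasDerivAt_powNorm_one (margFst_mem hP).1
  rw [(margFst_mem hP).2, Real.negMulLog_one, zero_sub] at hH
  have hG1 : ∑ y, powNorm 1 (fun x => P (x, y)) = 1 := by
    simpa [powNorm, margSnd] using (margSnd_mem hP).2
  have hH1 : powNorm 1 (margFst P) = 1 := by
    simpa [powNorm] using (margFst_mem hP).2
  have hL := (hG.log (by rw [hG1]; exact one_ne_zero)).sub
    (hH.log (by rw [hH1]; exact one_ne_zero))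
  rw [hG1, hH1, div_one, div_one] at hL
  have hs := hL.tendsto_slope.mono_left (nhdsWithin_mono 1 (fun x (hx : 1 < x) => hx.ne'))
  have hid : Tendsto (fun a : ℝ => a) (𝓝[>] 1) (𝓝 1) := tendsto_id.mono_left nhdsWithin_le_nhds
  have h2 := hid.mul hs
  have he : 1 * (shannonEntropy (margSnd P) - shannonEntropy P - -shannonEntropy (margFst P))
      = mutualInfo P := by unfold mutualInfo; ring
  rw [he] at h2
  refine h2.congr' ?_
  filter_upwards [self_mem_nhdsWithin] with a (ha : 1 < a)
  rw [leakageReal_eq ha hP.1, Real.log_div (sum_powNorm_pos hP).ne' (powNorm_margFst_pos hP).ne',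
    slope_def_field]
  simp only [Pi.sub_apply, hG1, hH1, Real.log_one, sub_zero]
  ring

/-- The filter along which the leakages of order `a ∈ (1, ∞)` approach the one of order `α`. It
treats the orders in `(1, ∞)` and the two limiting orders alike. -/
def orderFilter (α : ℝ≥0∞) : Filter ℝ :=
  if α = 1 then 𝓝[>] 1 else if α = ∞ then atTop else pure α.toReal

instance orderFilter_neBot (α : ℝ≥0∞) : (orderFilter α).NeBot := by
  unfold orderFilter
  split_ifs <;> infer_instance

lemma one_lt_toReal {α : ℝ≥0∞} (hα : 1 < α) (h : α ≠ ∞) : 1 < α.toReal := by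
  rw [← ENNReal.toReal_one]
  exact ENNReal.toReal_strict_mono h hα

lemma eventually_one_lt {α : ℝ≥0∞} (hα : 1 ≤ α) : ∀ᶠ a in orderFilter α, 1 < a := by
  unfold orderFilter
  split_ifs with h1 h2
  · exact self_mem_nhdsWithin
  · exact eventually_gt_atTop 1
  · exact one_lt_toReal (lt_of_le_of_ne hα (Ne.symm h1)) h2

lemma eventually_le_toReal {α β : ℝ≥0∞} (h : α ≤ β) (hβ : 1 < β) (hβ' : β ≠ ∞) :
    ∀ᶠ a in orderFilter α, a ≤ β.toReal := by
  unfold orderFilter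
  split_ifs with h1 h2
  · exact mem_nhdsWithin_of_mem_nhds
      ((eventually_lt_nhds (one_lt_toReal hβ hβ')).mono fun _ => le_of_lt)
  · exact absurd (top_le_iff.1 (h2 ▸ h)) hβ'
  · exact ENNReal.toReal_mono hβ' h

lemma tendsto_leakage (α : ℝ≥0∞) {P : A × B → ℝ} (hP : P ∈ stdSimplex ℝ (A × B)) :
    Tendsto (fun a => leakageReal a P) (orderFilter α) (𝓝 (leakage α P)) := by
  unfold orderFilter leakage
  split_ifs with h1 h2
  · exact tendsto_nhds_limUnder ⟨_, tendsto_leakageReal_one hP⟩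
  · exact tendsto_nhds_limUnder ⟨_, tendsto_leakageReal_atTop hP⟩
  · exact tendsto_pure_nhds (fun a => leakageReal a P) _

lemma leakage_one {P : A × B → ℝ} (hP : P ∈ stdSimplex ℝ (A × B)) :
    leakage 1 P = mutualInfo P := by
  rw [leakage, if_pos rfl]
  exact (tendsto_leakageReal_one hP).limUnder_eq

lemma leakage_top {P : A × B → ℝ} (hP : P ∈ stdSimplex ℝ (A × B)) :
    leakage ∞ P = Real.log
      ((∑ y, supOn (fun _ => 1) (fun x => P (x, y))) / supOn (fun _ => 1) (margFst P)) := by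
  rw [leakage, if_neg ENNReal.top_ne_one, if_pos rfl]
  exact (tendsto_leakageReal_atTop hP).limUnder_eq

lemma leakage_of_ne {α : ℝ≥0∞} (h1 : 1 < α) (h2 : α ≠ ∞) (P : A × B → ℝ) :
    leakage α P = leakageReal α.toReal P := by
  rw [leakage, if_neg h1.ne', if_neg h2]

end Limits

end

/-! ### Markov chains as matrix products, data processing and quasi-convexity -/

noncomputable section

/-- The composition (matrix product) of a measure-valued family `q` with a channel `W`. If
`q u x` is the joint law of `(U, X)`, then `compose q W u y` is that of `(U, Y)` for the Markov
chain `U - X - Y` with channel `W` from `X` to `Y`. -/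
def compose {U X Y : Type*} [Fintype X] (q : U → X → ℝ) (W : X → Y → ℝ) (u : U) (y : Y) : ℝ :=
  ∑ x, q u x * W x y

/-- `q` is a joint law of `(U, X)` (in curried form) in which `X` has law `p`. -/
def IsSplitting {U X : Type*} [Fintype U] (q : U → X → ℝ) (p : X → ℝ) : Prop :=
  (∀ u x, 0 ≤ q u x) ∧ ∀ x, ∑ u, q u x = p x

section Chains

variable {U X Y Z : Type*} [Fintype U] [Fintype X] [Fintype Y] [Fintype Z]
  {q : U → X → ℝ} {p : X → ℝ} {W W' : X → Y → ℝ} {V : Y → Z → ℝ} {a : ℝ} {α : ℝ≥0∞}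

omit [Fintype U] [Fintype Z] in
lemma compose_assoc : compose (compose q W) V = compose q (compose W V) := by
  funext u z
  simp only [compose, Finset.sum_mul, Finset.mul_sum]
  rw [Finset.sum_comm]
  simp only [mul_assoc]

omit [Fintype X] in
lemma channels_nonneg (hW : W ∈ channels X Y) (x : X) (y : Y) : 0 ≤ W x y := (hW x).1 y

omit [Fintype X] in
lemma compose_mem_channels (hW : W ∈ channels X Y) (hV : V ∈ channels Y Z) :
    compose W V ∈ channels X Z := fun x =>
  ⟨fun z => Finset.sum_nonneg fun y _ => mul_nonneg (channels_nonneg hW x y)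
    (channels_nonneg hV y z), by
    simp only [compose]
    rw [Finset.sum_comm]
    simp only [← Finset.mul_sum, (hV _).2, mul_one, (hW x).2]⟩

omit [Fintype X] in
lemma IsSplitting.le (hq : IsSplitting q p) (u : U) (x : X) : q u x ≤ p x :=
  hq.2 x ▸ Finset.single_le_sum (fun v _ => hq.1 v x) (Finset.mem_univ u)

lemma IsSplitting.sum_eq_one (hq : IsSplitting q p) (hp : p ∈ stdSimplex ℝ X) :
    ∑ u, ∑ x, q u x = 1 := by
  rw [Finset.sum_comm, ← hp.2]
  exact Finset.sum_congr rfl fun x _ => hq.2 x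

omit [Fintype Y] in
lemma IsSplitting.compose (hq : IsSplitting q p) (hW : ∀ x y, 0 ≤ W x y) :
    IsSplitting (compose q W) (fun y => ∑ x, p x * W x y) :=
  ⟨fun u y => Finset.sum_nonneg fun x _ => mul_nonneg (hq.1 u x) (hW x y), fun y => by
    simp only [MaxAlphaLeakage.compose]
    rw [Finset.sum_comm]
    simp only [← Finset.sum_mul, hq.2]⟩

omit [Fintype U] in
lemma sum_compose (hW : W ∈ channels X Y) (q : U → X → ℝ) (u : U) :
    ∑ y, compose q W u y = ∑ x, q u x := by
  simp only [compose]
  rw [Finset.sum_comm]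
  simp only [← Finset.mul_sum, (hW _).2, mul_one]

omit [Fintype U] in
lemma margFst_compose (hW : W ∈ channels X Y) (q : U → X → ℝ) :
    margFst (Function.uncurry (compose q W)) = fun u => ∑ x, q u x :=
  funext fun u => sum_compose hW q u

lemma uncurry_mem_stdSimplex (hq : IsSplitting q p) (hp : p ∈ stdSimplex ℝ X) :
    Function.uncurry q ∈ stdSimplex ℝ (U × X) :=
  ⟨fun z => hq.1 z.1 z.2, by
    rw [Fintype.sum_prod_type]; exact hq.sum_eq_one hp⟩

lemma sum_mul_mem_stdSimplex (hp : p ∈ stdSimplex ℝ X) (hW : W ∈ channels X Y) :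
    (fun y => ∑ x, p x * W x y) ∈ stdSimplex ℝ Y :=
  ⟨fun y => Finset.sum_nonneg fun x _ => mul_nonneg (hp.1 x) (channels_nonneg hW x y), by
    rw [Finset.sum_comm]
    simp only [← Finset.mul_sum, (hW _).2, mul_one, hp.2]⟩

lemma compose_mem_stdSimplex (hq : IsSplitting q p) (hp : p ∈ stdSimplex ℝ X)
    (hW : W ∈ channels X Y) :
    Function.uncurry (compose q W) ∈ stdSimplex ℝ (U × Y) :=
  uncurry_mem_stdSimplex (hq.compose (channels_nonneg hW)) (sum_mul_mem_stdSimplex hp hW)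

lemma jointLaw_mem_stdSimplex (hp : p ∈ stdSimplex ℝ X) (hW : W ∈ channels X Y) :
    jointLaw p W ∈ stdSimplex ℝ (X × Y) :=
  ⟨fun z => mul_nonneg (hp.1 _) (channels_nonneg hW _ _), by
    rw [Fintype.sum_prod_type]
    simp only [jointLaw, ← Finset.mul_sum, (hW _).2, mul_one, hp.2]⟩

omit [Fintype X] in
lemma margFst_jointLaw (hW : W ∈ channels X Y) : margFst (jointLaw p W) = p := by
  funext x
  simp only [margFst, jointLaw, ← Finset.mul_sum, (hW x).2, mul_one]

/-- Every joint law has a channel; its rows outside the support of the first marginal are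
arbitrary. -/
lemma exists_channel {P : X × Y → ℝ} (hP : P ∈ stdSimplex ℝ (X × Y)) :
    ∃ W ∈ channels X Y, P = jointLaw (margFst P) W := by
  classical
  obtain ⟨z⟩ := nonempty_of_mem_stdSimplex hP
  refine ⟨fun x => if margFst P x = 0 then Pi.single z.2 1 else fun y => P (x, y) / margFst P x,
    fun x => ?_, ?_⟩
  · by_cases h : margFst P x = 0
    · simp only [h, if_true]
      exact single_mem_stdSimplex ℝ z.2
    · simp only [h, if_false]
      exact ⟨fun y => div_nonneg (hP.1 _) ((margFst_mem hP).1 x), by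
        rw [← Finset.sum_div]; exact div_self h⟩
  · funext ⟨x, y⟩
    by_cases h : margFst P x = 0
    · simp only [jointLaw, h, zero_mul]
      exact (Finset.sum_eq_zero_iff_of_nonneg (fun y _ => hP.1 (x, y))).1 h y (Finset.mem_univ y)
    · simp only [jointLaw, h, if_false]
      rw [mul_div_cancel₀ _ h]

/-- The maximal leakage is at most `B` if the leakage from `U` is, for every joint law of
`(U, X)`: the Markov chain is determined by that law and the channel. -/
lemma maxLeakage_jointLaw_le (hW : W ∈ channels X Y) {B : EReal}
    (h : ∀ (n : ℕ) (q : Fin n → X → ℝ), IsSplitting q p →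
      ((leakage α (Function.uncurry (compose q W)) : ℝ) : EReal) ≤ B) :
    maxLeakage α (jointLaw p W) ≤ B := by
  refine iSup_le fun n => iSup_le fun Q => iSup_le fun ⟨hQ, hM, hmar⟩ => ?_
  have hsplit : IsSplitting (fun u x => ∑ y, Q (u, x, y)) p := by
    refine ⟨fun u x => Finset.sum_nonneg fun y _ => hQ.1 _, fun x => ?_⟩
    rw [Finset.sum_comm]
    simp only [hmar, jointLaw, ← Finset.mul_sum, (hW x).2, mul_one]
  have hfac : ∀ u x y, Q (u, x, y) = (∑ y, Q (u, x, y)) * W x y := by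
    intro u x y
    have h1 := hM u x y
    rw [hmar, hsplit.2] at h1
    -- The Markov property says nothing about `Q` where `p x = 0`, but there `Q` vanishes.
    by_cases hx : p x = 0
    · have h2 : ∑ y, Q (u, x, y) = 0 :=
        le_antisymm (hx ▸ hsplit.le u x) (hsplit.1 u x)
      rw [h2, zero_mul]
      exact (Finset.sum_eq_zero_iff_of_nonneg (fun y _ => hQ.1 (u, x, y))).1 h2 y
        (Finset.mem_univ y)
    · apply mul_right_cancel₀ hx
      rw [h1]
      simp only [jointLaw]
      ring
  convert h n _ hsplit using 3
  funext ⟨u, y⟩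
  exact Finset.sum_congr rfl fun x _ => hfac u x y

/-- The leakage is invariant under relabelling the first component. -/
lemma leakage_equiv (hα : 1 ≤ α) {U' : Type*} [Fintype U'] (e : U' ≃ U) {P : U × Y → ℝ}
    (hP : P ∈ stdSimplex ℝ (U × Y)) :
    leakage α (fun z : U' × Y => P (e z.1, z.2)) = leakage α P := by
  have hP' : (fun z : U' × Y => P (e z.1, z.2)) ∈ stdSimplex ℝ (U' × Y) :=
    ⟨fun z => hP.1 _, by
      rw [← hP.2, Fintype.sum_prod_type, Fintype.sum_prod_type]
      exact Equiv.sum_comp e fun u => ∑ y, P (u, y)⟩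
  have hU := nonempty_fst_of_mem hP
  have hU' := nonempty_fst_of_mem hP'
  refine tendsto_nhds_unique (tendsto_leakage α hP') ((tendsto_leakage α hP).congr' ?_)
  filter_upwards [eventually_one_lt hα] with a ha
  rw [leakageReal_eq ha hP.1, leakageReal_eq ha hP'.1]
  have h1 := powNorm_equiv (a := a) e (margFst P)
  have h2 := fun y => powNorm_equiv (a := a) e (fun u => P (u, y))
  simp only [h2, ← h1]
  rfl

/-- The alphabet of `U` may be any finite type. -/
lemma leakage_le_maxLeakage (hα : 1 ≤ α) (hp : p ∈ stdSimplex ℝ X) (hW : W ∈ channels X Y)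
    (hq : IsSplitting q p) :
    ((leakage α (Function.uncurry (compose q W)) : ℝ) : EReal) ≤ maxLeakage α (jointLaw p W) := by
  rw [← leakage_equiv hα (Fintype.equivFin U).symm (compose_mem_stdSimplex hq hp hW)]
  set e := (Fintype.equivFin U).symm
  have hsum : ∀ x, ∑ i, q (e i) x = p x := fun x => by
    rw [← hq.2]; exact Equiv.sum_comp e fun u => q u x
  have hone : ∀ x, ∑ y, W x y = 1 := fun x => (hW x).2
  refine le_iSup_of_le (Fintype.card U) (le_iSup_of_le
    (fun z => q (e z.1) z.2.1 * W z.2.1 z.2.2) (le_iSup_of_le ⟨⟨?_, ?_⟩, ?_, ?_⟩ le_rfl))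
  · exact fun z => mul_nonneg (hq.1 _ _) (channels_nonneg hW _ _)
  · simp only [Fintype.sum_prod_type, ← Finset.mul_sum, hone, mul_one]
    rw [Finset.sum_comm]
    simp only [hsum, hp.2]
  · intro i x y
    simp only [← Finset.mul_sum, ← Finset.sum_mul, hone, mul_one, hsum]
    ring
  · intro x y
    simp only [← Finset.sum_mul, hsum, jointLaw]

/-- Data processing for the observation: the columns of the composed law are conic combinations
of the old ones, so this is Minkowski's inequality. -/
lemma leakageReal_compose_le (ha : 1 < a) (hq : IsSplitting q p) (hp : p ∈ stdSimplex ℝ X)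
    (hW : W ∈ channels X Y) :
    leakageReal a (Function.uncurry (compose q W)) ≤ leakageReal a (Function.uncurry q) := by
  have h1 := compose_mem_stdSimplex hq hp hW
  have h2 := uncurry_mem_stdSimplex hq hp
  have hU := nonempty_fst_of_mem h2
  rw [leakageReal_eq ha h1.1, leakageReal_eq ha h2.1, margFst_compose hW]
  refine mul_le_mul_of_nonneg_left ?_ (div_nonneg (by linarith) (by linarith))
  have hm := powNorm_margFst_pos (a := a) h2
  refine Real.log_le_log (div_pos (sum_powNorm_pos h1)
    (by exact hm)) (div_le_div_of_nonneg_right ?_ hm.le)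
  calc ∑ y, powNorm a (fun u => Function.uncurry (compose q W) (u, y))
      ≤ ∑ y, ∑ x, W x y * powNorm a (fun u => q u x) := by
        refine Finset.sum_le_sum fun y _ => ?_
        refine (powNorm_sum_le ha.le (fun x u => q u x * W x y)
          (fun x u => mul_nonneg (hq.1 u x) (channels_nonneg hW x y)) Finset.univ).trans_eq ?_
        refine Finset.sum_congr rfl fun x _ => ?_
        rw [← powNorm_const_mul (by linarith) (channels_nonneg hW x y) (fun u => hq.1 u x)]
        simp only [mul_comm]
    _ = ∑ x, powNorm a (fun u => Function.uncurry q (u, x)) := by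
        rw [Finset.sum_comm]
        simp only [← Finset.sum_mul, (hW _).2, one_mul, Function.uncurry_apply_pair]

lemma leakage_compose_le (hα : 1 ≤ α) (hq : IsSplitting q p) (hp : p ∈ stdSimplex ℝ X)
    (hW : W ∈ channels X Y) :
    leakage α (Function.uncurry (compose q W)) ≤ leakage α (Function.uncurry q) := by
  refine le_of_tendsto_of_tendsto (tendsto_leakage α (compose_mem_stdSimplex hq hp hW))
    (tendsto_leakage α (uncurry_mem_stdSimplex hq hp)) ?_
  filter_upwards [eventually_one_lt hα] with a ha
  exact leakageReal_compose_le ha hq hp hW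

lemma leakage_nonneg (hα : 1 ≤ α) {P : X × Y → ℝ} (hP : P ∈ stdSimplex ℝ (X × Y)) :
    0 ≤ leakage α P := by
  refine ge_of_tendsto (tendsto_leakage α hP) ?_
  filter_upwards [eventually_one_lt hα] with a ha
  have hU := nonempty_fst_of_mem hP
  rw [leakageReal_eq ha hP.1]
  refine mul_nonneg (div_nonneg (by linarith) (by linarith)) (Real.log_nonneg ?_)
  rw [one_le_div (powNorm_margFst_pos hP)]
  exact powNorm_sum_le ha.le (fun y x => P (x, y)) (fun y x => hP.1 _) Finset.univ

/-- For a fixed joint law of `(U, X)`, the exponential of a multiple of the leakage is convex in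
the channel, so the leakage is quasi-convex; the bound passes to the limiting orders. -/
lemma leakage_convexCombo_le (hα : 1 ≤ α) (hq : IsSplitting q p) (hp : p ∈ stdSimplex ℝ X)
    (hW : W ∈ channels X Y) (hW' : W' ∈ channels X Y) {s t : ℝ} (hs : 0 ≤ s) (ht : 0 ≤ t)
    (hst : s + t = 1) (hc : s • W + t • W' ∈ channels X Y) :
    leakage α (Function.uncurry (compose q (s • W + t • W'))) ≤
      max (leakage α (Function.uncurry (compose q W)))
        (leakage α (Function.uncurry (compose q W'))) := by
  have h0 := compose_mem_stdSimplex hq hp hc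
  have h1 := compose_mem_stdSimplex hq hp hW
  have h2 := compose_mem_stdSimplex hq hp hW'
  refine le_of_tendsto_of_tendsto (tendsto_leakage α h0)
    ((tendsto_leakage α h1).max (tendsto_leakage α h2)) ?_
  filter_upwards [eventually_one_lt hα] with a ha
  have hU := nonempty_fst_of_mem h0
  have hpos : 0 ≤ a / (a - 1) := div_nonneg (by linarith) (by linarith)
  rw [leakageReal_eq ha h0.1, leakageReal_eq ha h1.1, leakageReal_eq ha h2.1,
    margFst_compose hc, margFst_compose hW, margFst_compose hW', ← mul_max_of_nonneg _ _ hpos]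
  refine mul_le_mul_of_nonneg_left ?_ hpos
  have hm := powNorm_margFst_pos (a := a) h0
  rw [margFst_compose hc] at hm
  have hconv : ∑ y, powNorm a (fun u => Function.uncurry (compose q (s • W + t • W')) (u, y)) ≤
      s * ∑ y, powNorm a (fun u => Function.uncurry (compose q W) (u, y)) +
      t * ∑ y, powNorm a (fun u => Function.uncurry (compose q W') (u, y)) := by
    rw [Finset.mul_sum, Finset.mul_sum, ← Finset.sum_add_distrib]
    refine Finset.sum_le_sum fun y _ => ?_
    have hn1 : ∀ u, 0 ≤ compose q W u y := fun u => h1.1 (u, y)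
    have hn2 : ∀ u, 0 ≤ compose q W' u y := fun u => h2.1 (u, y)
    have := powNorm_sum_le ha.le (fun (b : Bool) u => if b then s * compose q W u y else
      t * compose q W' u y) (fun b u => by
        cases b
        · exact mul_nonneg ht (hn2 u)
        · exact mul_nonneg hs (hn1 u)) Finset.univ
    simp only [Fintype.sum_bool, if_true, Bool.false_eq_true, if_false] at this
    rw [powNorm_const_mul (by linarith) hs hn1, powNorm_const_mul (by linarith) ht hn2] at this
    refine le_trans (le_of_eq ?_) this
    congr 1
    funext u
    simp only [Function.uncurry_apply_pair, compose, Pi.add_apply, Pi.smul_apply, smul_eq_mul,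
      mul_add, Finset.sum_add_distrib, Finset.mul_sum]
    congr 1 <;> exact Finset.sum_congr rfl fun x _ => by ring
  have hA := sum_powNorm_pos (a := a) h1
  have hB := sum_powNorm_pos (a := a) h2
  have hC := sum_powNorm_pos (a := a) h0
  set SA := ∑ y, powNorm a (fun u => Function.uncurry (compose q W) (u, y))
  set SB := ∑ y, powNorm a (fun u => Function.uncurry (compose q W') (u, y))
  rcases le_total SA SB with hle | hle
  · refine le_max_of_le_right (Real.log_le_log (div_pos hC hm)
      (div_le_div_of_nonneg_right (hconv.trans ?_) hm.le))
    calc s * SA + t * SB ≤ s * SB + t * SB :=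
          add_le_add_left (mul_le_mul_of_nonneg_left hle hs) _
      _ = SB := by rw [← add_mul, hst, one_mul]
  · refine le_max_of_le_left (Real.log_le_log (div_pos hC hm)
      (div_le_div_of_nonneg_right (hconv.trans ?_) hm.le))
    calc s * SA + t * SB ≤ s * SA + t * SA :=
          add_le_add_right (mul_le_mul_of_nonneg_left hle ht) _
      _ = SA := by rw [← add_mul, hst, one_mul]

omit [Fintype X] in
lemma convex_channels : Convex ℝ (channels X Y) := by
  intro W hW W' hW' s t hs ht hst x
  exact convex_stdSimplex ℝ Y (hW x) (hW' x) hs ht hst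

lemma quasiconvexOn_maxLeakage (hα : 1 ≤ α) (hp : p ∈ stdSimplex ℝ X) :
    QuasiconvexOn ℝ (channels X Y) (fun W => maxLeakage α (jointLaw p W)) := by
  intro r W ⟨hW, hr⟩ W' ⟨hW', hr'⟩ s t hs ht hst
  have hc := convex_channels hW hW' hs ht hst
  refine ⟨hc, maxLeakage_jointLaw_le hc fun n q hq => ?_⟩
  refine (EReal.coe_le_coe_iff.2
    (leakage_convexCombo_le hα hq hp hW hW' hs ht hst hc)).trans ?_
  rw [EReal.coe_strictMono.monotone.map_max]
  exact max_le ((leakage_le_maxLeakage hα hp hW hq).trans hr)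
    ((leakage_le_maxLeakage hα hp hW' hq).trans hr')

lemma maxLeakage_compose_le_left (hα : 1 ≤ α) (hp : p ∈ stdSimplex ℝ X) (hW : W ∈ channels X Y)
    (hV : V ∈ channels Y Z) :
    maxLeakage α (jointLaw p (compose W V)) ≤ maxLeakage α (jointLaw p W) := by
  refine maxLeakage_jointLaw_le (compose_mem_channels hW hV) fun n q hq => ?_
  refine le_trans ?_ (leakage_le_maxLeakage hα hp hW hq)
  rw [← compose_assoc, EReal.coe_le_coe_iff]
  exact leakage_compose_le hα (hq.compose (channels_nonneg hW)) (sum_mul_mem_stdSimplex hp hW) hV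

lemma maxLeakage_compose_le_right (hα : 1 ≤ α) (hp : p ∈ stdSimplex ℝ X) (hW : W ∈ channels X Y)
    (hV : V ∈ channels Y Z) :
    maxLeakage α (jointLaw p (compose W V)) ≤
      maxLeakage α (jointLaw (fun y => ∑ x, p x * W x y) V) := by
  refine maxLeakage_jointLaw_le (compose_mem_channels hW hV) fun n q hq => ?_
  rw [← compose_assoc]
  exact leakage_le_maxLeakage hα (sum_mul_mem_stdSimplex hp hW) hV
    (hq.compose (channels_nonneg hW))

/-- The laws of the pairs in a Markov chain `X - Y - Z`, in terms of the input law and the two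
channels. -/
lemma IsMarkovChain.exists_channels {Q : X × Y × Z → ℝ} (hQ : Q ∈ stdSimplex ℝ (X × Y × Z))
    (hM : IsMarkovChain Q) :
    ∃ p ∈ stdSimplex ℝ X, ∃ W ∈ channels X Y, ∃ V ∈ channels Y Z,
      (fun w : X × Y => ∑ z, Q (w.1, w.2, z)) = jointLaw p W ∧
      (fun w : Y × Z => ∑ x, Q (x, w.1, w.2)) = jointLaw (fun y => ∑ x, p x * W x y) V ∧
      (fun w : X × Z => ∑ y, Q (w.1, y, w.2)) = jointLaw p (compose W V) := by
  have h1 : (fun w : X × Y => ∑ z, Q (w.1, w.2, z)) ∈ stdSimplex ℝ (X × Y) :=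
    ⟨fun _ => Finset.sum_nonneg fun _ _ => hQ.1 _, by
      rw [← hQ.2]; simp only [Fintype.sum_prod_type]⟩
  have h2 : (fun w : Y × Z => ∑ x, Q (x, w.1, w.2)) ∈ stdSimplex ℝ (Y × Z) :=
    ⟨fun _ => Finset.sum_nonneg fun _ _ => hQ.1 _, by
      rw [← hQ.2]; simp only [Fintype.sum_prod_type_right]⟩
  obtain ⟨W, hW, hPW⟩ := exists_channel h1
  obtain ⟨V, hV, hPV⟩ := exists_channel h2
  set p := margFst (fun w : X × Y => ∑ z, Q (w.1, w.2, z)) with hpdef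
  have hxy : ∀ x y, ∑ z, Q (x, y, z) = p x * W x y := fun x y => congrFun hPW (x, y)
  have hy : margFst (fun w : Y × Z => ∑ x, Q (x, w.1, w.2)) = fun y => ∑ x, p x * W x y := by
    funext y
    simp only [margFst, ← hxy]
    rw [Finset.sum_comm]
  rw [hy] at hPV
  have hyz : ∀ y z, ∑ x, Q (x, y, z) = (∑ x, p x * W x y) * V y z :=
    fun y z => congrFun hPV (y, z)
  refine ⟨p, margFst_mem h1, W, hW, V, hV, hPW, hPV, ?_⟩
  funext ⟨x, z⟩
  simp only [jointLaw, compose, Finset.mul_sum]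
  refine Finset.sum_congr rfl fun y _ => ?_
  have hm := hM x y z
  simp only [hxy, hyz] at hm
  -- Where the law of `Y` vanishes, the Markov identity is void and both sides are zero.
  by_cases h0 : ∑ x, p x * W x y = 0
  · have h3 : p x * W x y = 0 := (Finset.sum_eq_zero_iff_of_nonneg (fun x _ =>
      mul_nonneg ((margFst_mem h1).1 x) (channels_nonneg hW x y))).1 h0 x (Finset.mem_univ x)
    rw [← mul_assoc, h3, zero_mul]
    exact (Finset.sum_eq_zero_iff_of_nonneg (fun z _ => hQ.1 (x, y, z))).1
      ((hxy x y).trans h3) z (Finset.mem_univ z)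
  · apply mul_right_cancel₀ h0
    rw [hm]
    ring

end Chains

end

/-! ### Maximal leakage as a supremum of Sibson mutual informations -/

noncomputable section

/-- The closed form of the Sibson mutual information of order `a ∈ (1, ∞)` for the input law `p`
and the channel `W`. -/
def sibsonForm {X Y : Type*} [Fintype X] [Fintype Y] (a : ℝ) (p : X → ℝ) (W : X → Y → ℝ) : ℝ :=
  a / (a - 1) * Real.log (∑ y, wNorm a p (fun x => W x y))

/-- The closed form of the Sibson mutual information of order `∞`. -/
def sibsonFormTop {X Y : Type*} [Fintype X] [Fintype Y] (p : X → ℝ) (W : X → Y → ℝ) : ℝ :=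
  Real.log (∑ y, supOn p (fun x => W x y))

section Interpolation

variable {U X Y : Type*} [Fintype U] [Fintype X] [Fintype Y]
  {q : U → X → ℝ} {p : X → ℝ} {W : X → Y → ℝ} {a b : ℝ}

lemma sum_wNorm_pos (hp : p ∈ stdSimplex ℝ X) (hW : W ∈ channels X Y) :
    0 < ∑ y, wNorm a p (fun x => W x y) := by
  obtain ⟨x, hx⟩ := exists_pos_of_mem_stdSimplex hp
  obtain ⟨y, hy⟩ := exists_pos_of_mem_stdSimplex (hW x)
  refine Finset.sum_pos' (fun y _ => wNorm_nonneg hp.1 fun x => channels_nonneg hW x y)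
    ⟨y, Finset.mem_univ _, Real.rpow_pos_of_pos (Finset.sum_pos' (fun x _ => mul_nonneg (hp.1 x)
      (Real.rpow_nonneg (channels_nonneg hW x y) a)) ⟨x, Finset.mem_univ _, ?_⟩) _⟩
  exact mul_pos hx (Real.rpow_pos_of_pos hy a)

lemma sum_supOn_pos (hp : p ∈ stdSimplex ℝ X) (hW : W ∈ channels X Y) :
    0 < ∑ y, supOn p (fun x => W x y) := by
  obtain ⟨x, hx⟩ := exists_pos_of_mem_stdSimplex hp
  obtain ⟨y, hy⟩ := exists_pos_of_mem_stdSimplex (hW x)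
  exact Finset.sum_pos' (fun y _ => supOn_nonneg fun x => channels_nonneg hW x y)
    ⟨y, Finset.mem_univ _, hy.trans_le (le_supOn p (fun x => W x y) hx)⟩

lemma tendsto_sibsonForm_atTop (hp : p ∈ stdSimplex ℝ X) (hW : W ∈ channels X Y) :
    Tendsto (fun a => sibsonForm a p W) atTop (𝓝 (sibsonFormTop p W)) := by
  have h := tendsto_div_sub_one_atTop.mul ((tendsto_finsetSum (Finset.univ : Finset Y) fun y _ =>
    tendsto_wNorm_atTop hp.1 fun x => channels_nonneg hW x y).log (sum_supOn_pos hp hW).ne')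
  rwa [one_mul] at h

/-- Hölder's inequality in the form of a weighted geometric mean. -/
lemma sum_rpow_mul_rpow_le {ι : Type*} (s : Finset ι) {u v : ι → ℝ} (hu : ∀ i, 0 ≤ u i)
    (hv : ∀ i, 0 ≤ v i) {l m : ℝ} (hl : 0 < l) (hm : 0 < m) (hlm : l + m = 1) :
    ∑ i ∈ s, u i ^ l * v i ^ m ≤ (∑ i ∈ s, u i) ^ l * (∑ i ∈ s, v i) ^ m := by
  have h := Real.inner_le_Lp_mul_Lq_of_nonneg (s := s) (f := fun i => u i ^ l)
    (g := fun i => v i ^ m) (Real.holderConjugate_one_div hl hm hlm)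
    (fun i _ => Real.rpow_nonneg (hu i) l) (fun i _ => Real.rpow_nonneg (hv i) m)
  simpa only [← Real.rpow_mul (hu _), ← Real.rpow_mul (hv _), mul_one_div_cancel hl.ne',
    mul_one_div_cancel hm.ne', Real.rpow_one, one_div_one_div] using h

/-- Interpolation of `L^a` between `L^1` and `L^b`. -/
lemma wNorm_le_interpolate (ha : 1 < a) (hab : a < b) {f : X → ℝ} (hp : ∀ x, 0 ≤ p x)
    (hf : ∀ x, 0 ≤ f x) :
    wNorm a p f ≤ (∑ x, p x * f x) ^ ((b - a) / ((b - 1) * a)) *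
      wNorm b p f ^ ((a - 1) * b / ((b - 1) * a)) := by
  have hb1 : 0 < b - 1 := by linarith
  have ha0 : 0 < a := by linarith
  have hb0 : 0 < b := by linarith
  set l := (b - a) / (b - 1) with hl
  set m := (a - 1) / (b - 1) with hm
  have hl0 : 0 < l := div_pos (by linarith) hb1
  have hm0 : 0 < m := div_pos (by linarith) hb1
  have hlm : l + m = 1 := by rw [hl, hm]; field_simp; ring
  have hlb : l + b * m = a := by rw [hl, hm]; field_simp; ring
  have h := sum_rpow_mul_rpow_le Finset.univ (u := fun x => p x * f x)
    (v := fun x => p x * f x ^ b) (fun x => mul_nonneg (hp x) (hf x))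
    (fun x => mul_nonneg (hp x) (Real.rpow_nonneg (hf x) b)) hl0 hm0 hlm
  have h1 : ∀ x, (p x * f x) ^ l * (p x * f x ^ b) ^ m = p x * f x ^ a := fun x => by
    rw [Real.mul_rpow (hp x) (hf x), Real.mul_rpow (hp x) (Real.rpow_nonneg (hf x) b),
      ← Real.rpow_mul (hf x), mul_mul_mul_comm, ← Real.rpow_add_of_nonneg (hp x) hl0.le hm0.le,
      ← Real.rpow_add_of_nonneg (hf x) hl0.le (by positivity), hlm, hlb, Real.rpow_one]
  simp only [h1] at h
  have hA : 0 ≤ ∑ x, p x * f x := Finset.sum_nonneg fun x _ => mul_nonneg (hp x) (hf x)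
  have hB : 0 ≤ ∑ x, p x * f x ^ b :=
    Finset.sum_nonneg fun x _ => mul_nonneg (hp x) (Real.rpow_nonneg (hf x) b)
  refine (Real.rpow_le_rpow (Finset.sum_nonneg fun x _ =>
    mul_nonneg (hp x) (Real.rpow_nonneg (hf x) a)) h (by positivity)).trans_eq ?_
  rw [Real.mul_rpow (Real.rpow_nonneg hA _) (Real.rpow_nonneg hB _), ← Real.rpow_mul hA,
    ← Real.rpow_mul hB, wNorm, ← Real.rpow_mul hB]
  congr 2
  · rw [hl]; field_simp
  · rw [hm]; field_simp

/-- The Sibson mutual information is nondecreasing in its order: interpolate each column of the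
channel between orders `1` and `b` and apply Hölder's inequality to the sum over the columns,
whose `L^1` norms add up to `1`. -/
lemma sibsonForm_mono (hp : p ∈ stdSimplex ℝ X) (hW : W ∈ channels X Y) (ha : 1 < a)
    (hab : a ≤ b) : sibsonForm a p W ≤ sibsonForm b p W := by
  rcases hab.eq_or_lt with rfl | hab
  · exact le_rfl
  have hb1 : 0 < b - 1 := by linarith
  have ha1 : 0 < a - 1 := by linarith
  have ha0 : 0 < a := by linarith
  have hb0 : 0 < b := by linarith
  have hba : 0 < b - a := by linarith
  have hs := sum_wNorm_pos (a := b) hp hW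
  have h1 : ∑ y, wNorm a p (fun x => W x y) ≤
      (∑ y, wNorm b p (fun x => W x y)) ^ ((a - 1) * b / ((b - 1) * a)) := by
    refine (Finset.sum_le_sum fun y _ => wNorm_le_interpolate ha hab hp.1
      fun x => channels_nonneg hW x y).trans ?_
    refine (sum_rpow_mul_rpow_le Finset.univ (fun y => Finset.sum_nonneg fun x _ =>
      mul_nonneg (hp.1 x) (channels_nonneg hW x y))
      (fun y => wNorm_nonneg hp.1 fun x => channels_nonneg hW x y)
      (by positivity) (by positivity) (by field_simp; ring)).trans_eq ?_
    rw [(sum_mul_mem_stdSimplex hp hW).2, Real.one_rpow, one_mul]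
  have h2 := Real.log_le_log (sum_wNorm_pos hp hW) h1
  rw [Real.log_rpow hs] at h2
  refine (mul_le_mul_of_nonneg_left h2 (by positivity : 0 ≤ a / (a - 1))).trans_eq ?_
  rw [sibsonForm, ← mul_assoc]
  congr 1
  field_simp

lemma sibsonForm_le_top (hp : p ∈ stdSimplex ℝ X) (hW : W ∈ channels X Y) (ha : 1 < a) :
    sibsonForm a p W ≤ sibsonFormTop p W := by
  refine ge_of_tendsto (tendsto_sibsonForm_atTop hp hW) ?_
  filter_upwards [eventually_ge_atTop a] with b hb
  exact sibsonForm_mono hp hW ha hb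

/-- Jensen's inequality for `t ↦ t ^ a` with unnormalized weights. -/
lemma sum_mul_rpow_le (ha : 1 < a) {w f : X → ℝ} (hw : ∀ x, 0 ≤ w x) (hf : ∀ x, 0 ≤ f x) :
    (∑ x, w x * f x) ^ a ≤ (∑ x, w x) ^ (a - 1) * ∑ x, w x * f x ^ a := by
  have ha0 : 0 < a := by linarith
  have hS : 0 ≤ ∑ x, w x := Finset.sum_nonneg fun x _ => hw x
  have hT : 0 ≤ ∑ x, w x * f x ^ a :=
    Finset.sum_nonneg fun x _ => mul_nonneg (hw x) (Real.rpow_nonneg (hf x) a)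
  refine (Real.rpow_le_rpow (Finset.sum_nonneg fun x _ => mul_nonneg (hw x) (hf x))
    (Real.inner_le_weight_mul_Lp_of_nonneg Finset.univ ha.le w f hw hf) ha0.le).trans_eq ?_
  rw [Real.mul_rpow (Real.rpow_nonneg hS _) (Real.rpow_nonneg hT _), ← Real.rpow_mul hS,
    ← Real.rpow_mul hT, inv_mul_cancel₀ ha0.ne', Real.rpow_one, sub_mul,
    inv_mul_cancel₀ ha0.ne', one_mul]

/-- The leakage from `U` in a Markov chain `U - X - Y` is at most the Sibson mutual information
of the channel from `X` to `Y` for a tilted input law, which has the same support as the law of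
`X`: by Jensen's inequality, applied to the conditional law of `X` given `U`. -/
lemma exists_leakageReal_compose_le_sibsonForm (ha : 1 < a) (hq : IsSplitting q p)
    (hp : p ∈ stdSimplex ℝ X) (hW : W ∈ channels X Y) :
    ∃ p' ∈ stdSimplex ℝ X, (∀ x, 0 < p' x ↔ 0 < p x) ∧
      leakageReal a (Function.uncurry (compose q W)) ≤ sibsonForm a p' W := by
  have ha0 : 0 < a := by linarith
  have h0 := compose_mem_stdSimplex hq hp hW
  have hU := nonempty_fst_of_mem h0
  have hm := powNorm_margFst_pos (a := a) h0
  rw [margFst_compose hW] at hm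
  set r : U → ℝ := fun u => ∑ x, q u x with hr
  have hr0 : ∀ u, 0 ≤ r u := fun u => Finset.sum_nonneg fun x _ => hq.1 u x
  set D := ∑ u, r u ^ a with hD
  have hD0 : 0 < D := by
    refine (sum_rpow_nonneg hr0).lt_of_ne fun h => hm.ne' ?_
    rw [powNorm, ← h, Real.zero_rpow (by positivity)]
  have hnn : ∀ u x, 0 ≤ r u ^ (a - 1) * q u x :=
    fun u x => mul_nonneg (Real.rpow_nonneg (hr0 u) _) (hq.1 u x)
  have hsum0 : ∀ x, 0 ≤ ∑ u, r u ^ (a - 1) * q u x :=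
    fun x => Finset.sum_nonneg fun u _ => hnn u x
  -- The tilted law is that of `X` when `U` has the law proportional to `r ^ a` and the conditional
  -- law of `X` given `U = u`, namely `q u x / r u`, is kept.
  refine ⟨fun x => (∑ u, r u ^ (a - 1) * q u x) / D, ⟨fun x => div_nonneg (hsum0 x) hD0.le, ?_⟩,
    fun x => ?_, ?_⟩
  · rw [← Finset.sum_div, Finset.sum_comm, div_eq_one_iff_eq hD0.ne']
    refine Finset.sum_congr rfl fun u _ => ?_
    rw [← Finset.mul_sum, ← Real.rpow_add_one' (hr0 u) (by linarith), sub_add_cancel]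
  · rw [div_pos_iff_of_pos_right hD0, ← hq.2]
    constructor
    · intro h
      refine (Finset.sum_nonneg fun u _ => hq.1 u x).lt_of_ne fun h1 => h.ne' ?_
      refine Finset.sum_eq_zero fun u hu => ?_
      rw [(Finset.sum_eq_zero_iff_of_nonneg fun u _ => hq.1 u x).1 h1.symm u hu, mul_zero]
    · intro h
      obtain ⟨u, hu, hux⟩ := Finset.exists_lt_of_sum_lt (s := Finset.univ)
        (f := fun _ : U => (0 : ℝ)) (g := fun u => q u x) (by simpa using h)
      refine Finset.sum_pos' (fun u _ => hnn u x) ⟨u, hu, mul_pos (Real.rpow_pos_of_pos ?_ _) hux⟩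
      exact lt_of_lt_of_le hux (Finset.single_le_sum (fun x _ => hq.1 u x) (Finset.mem_univ x))
  · rw [leakageReal_eq ha h0.1, margFst_compose hW]
    refine mul_le_mul_of_nonneg_left (Real.log_le_log (div_pos (sum_powNorm_pos h0) hm) ?_)
      (div_nonneg ha0.le (by linarith))
    rw [Finset.sum_div]
    refine Finset.sum_le_sum fun y _ => ?_
    rw [powNorm, powNorm, wNorm, ← Real.div_rpow (sum_rpow_nonneg fun u => h0.1 _) hD0.le]
    refine Real.rpow_le_rpow (div_nonneg (sum_rpow_nonneg fun u => h0.1 _) hD0.le) ?_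
      (by positivity)
    rw [div_le_iff₀ hD0, Finset.sum_mul]
    calc ∑ u, Function.uncurry (compose q W) (u, y) ^ a
        ≤ ∑ u, r u ^ (a - 1) * ∑ x, q u x * W x y ^ a := Finset.sum_le_sum fun u _ =>
          sum_mul_rpow_le ha (hq.1 u) fun x => channels_nonneg hW x y
      _ = _ := by
          simp only [Finset.mul_sum]
          rw [Finset.sum_comm]
          refine Finset.sum_congr rfl fun x _ => ?_
          rw [mul_right_comm, div_mul_cancel₀ _ hD0.ne', Finset.sum_mul]
          exact Finset.sum_congr rfl fun u _ => by ring

/-- A continuous function on the simplex takes all values between those at the uniform law and at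
a vertex. -/
lemma exists_mem_stdSimplex_eq {n : ℕ} (hn : 0 < n) {g : (Fin n → ℝ) → ℝ} (hg : Continuous g)
    {t : ℝ} (h0 : g (fun _ => 1 / (n : ℝ)) ≤ t) (h1 : t ≤ g (Pi.single ⟨0, hn⟩ 1)) :
    ∃ v ∈ stdSimplex ℝ (Fin n), g v = t := by
  have hu : (fun _ => 1 / (n : ℝ)) ∈ stdSimplex ℝ (Fin n) :=
    ⟨fun _ => by positivity, by
      have : (n : ℝ) ≠ 0 := by positivity
      simp [this]⟩
  exact (convex_stdSimplex ℝ (Fin n)).isPreconnected.intermediate_value hu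
    (single_mem_stdSimplex ℝ _) hg.continuousOn ⟨h0, h1⟩

/-- Laws on a common finite alphabet with prescribed sums of `b`-th powers. -/
lemma exists_split_sum_rpow (hb : 1 < b) {t : X → ℝ} (ht : ∀ x, 0 < t x) (ht1 : ∀ x, t x ≤ 1) :
    ∃ (n : ℕ) (v : X → Fin n → ℝ),
      ∀ x, v x ∈ stdSimplex ℝ (Fin n) ∧ ∑ i, v x i ^ b = t x := by
  have hb0 : 0 < b := by linarith
  have hlim : Tendsto (fun n : ℕ => (n : ℝ) ^ (-(b - 1))) atTop (𝓝 0) :=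
    (tendsto_rpow_neg_atTop (by linarith)).comp tendsto_natCast_atTop_atTop
  obtain ⟨n, hn, hn0⟩ := ((eventually_all.2 fun x => hlim.eventually_le_const (ht x)).and
    (eventually_gt_atTop 0)).exists
  have hn' : (0 : ℝ) < n := by exact_mod_cast hn0
  choose v hv using fun x => exists_mem_stdSimplex_eq hn0 (g := fun v => ∑ i, v i ^ b) (t := t x)
    (continuous_finsetSum _ fun i _ =>
      (continuous_apply i).rpow_const fun _ => Or.inr hb0.le) (by
        refine le_trans (le_of_eq ?_) (hn x)
        rw [Finset.sum_const, Finset.card_univ, Fintype.card_fin, nsmul_eq_mul, one_div,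
          Real.inv_rpow hn'.le, neg_sub, Real.rpow_sub hn', Real.rpow_one, div_eq_mul_inv]) (by
        refine (ht1 x).trans (le_trans (le_of_eq ?_) (Finset.single_le_sum (fun i _ =>
          Real.rpow_nonneg ((single_mem_stdSimplex ℝ (⟨0, hn0⟩ : Fin n)).1 i) b)
          (Finset.mem_univ ⟨0, hn0⟩)))
        simp)
  exact ⟨n, v, hv⟩

/-- Laws on a common finite alphabet with prescribed largest atoms (the norm is the sup norm). -/
lemma exists_split_norm {t : X → ℝ} (ht : ∀ x, 0 < t x) (ht1 : ∀ x, t x ≤ 1) :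
    ∃ (n : ℕ) (v : X → Fin n → ℝ), ∀ x, v x ∈ stdSimplex ℝ (Fin n) ∧ ‖v x‖ = t x := by
  have hlim : Tendsto (fun n : ℕ => 1 / (n : ℝ)) atTop (𝓝 0) :=
    tendsto_one_div_atTop_nhds_zero_nat
  obtain ⟨n, hn, hn0⟩ := ((eventually_all.2 fun x => hlim.eventually_le_const (ht x)).and
    (eventually_gt_atTop 0)).exists
  have hne : Nonempty (Fin n) := ⟨⟨0, hn0⟩⟩
  choose v hv using fun x => exists_mem_stdSimplex_eq hn0 (g := fun v => ‖v‖) (t := t x)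
    continuous_norm (by
      rw [pi_norm_const, Real.norm_of_nonneg (by positivity)]
      exact hn x) (by
      refine (ht1 x).trans (le_trans (le_of_eq ?_) (norm_le_pi_norm _ ⟨0, hn0⟩))
      simp)
  exact ⟨n, v, hv⟩

open Classical in
/-- The joint law of `(U, X)` for `U = (X, I)`, where the conditional law of `I` given `X = x`
is `v x`. -/
def shatter {n : ℕ} (p : X → ℝ) (v : X → Fin n → ℝ) (u : X × Fin n) (x : X) : ℝ :=
  if u.1 = x then p x * v x u.2 else 0

lemma isSplitting_shatter {n : ℕ} (hp : p ∈ stdSimplex ℝ X) {v : X → Fin n → ℝ}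
    (hv : ∀ x, v x ∈ stdSimplex ℝ (Fin n)) : IsSplitting (shatter p v) p := by
  refine ⟨fun u x => ?_, fun x => ?_⟩
  · unfold shatter
    split_ifs
    · exact mul_nonneg (hp.1 x) ((hv x).1 _)
    · exact le_rfl
  · classical
    rw [Fintype.sum_prod_type_right]
    simp only [shatter, Finset.sum_ite_eq', Finset.mem_univ, if_true, ← Finset.mul_sum,
      (hv x).2, mul_one]

omit [Fintype Y] in
lemma compose_shatter {n : ℕ} (v : X → Fin n → ℝ) (u : X × Fin n) (y : Y) :
    compose (shatter p v) W u y = p u.1 * v u.1 u.2 * W u.1 y := by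
  classical
  simp [compose, shatter, ite_mul]

lemma sum_shatter {n : ℕ} (v : X → Fin n → ℝ) (u : X × Fin n) :
    ∑ x, shatter p v u x = p u.1 * v u.1 u.2 := by
  classical
  simp [shatter]

/-- The Sibson mutual information of order `b` for an input law `p'` with the same support as `p`
is the leakage of a shattered input: the conditional laws are chosen so that the sum of the
`b`-th powers of the atoms of `U` above `x` is proportional to `p' x`. -/
lemma exists_leakageReal_eq_sibsonForm (hb : 1 < b) (hp : p ∈ stdSimplex ℝ X)
    (hW : W ∈ channels X Y) {p' : X → ℝ} (hp' : p' ∈ stdSimplex ℝ X)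
    (hpp' : ∀ x, 0 < p' x ↔ 0 < p x) :
    ∃ (n : ℕ) (q : X × Fin n → X → ℝ), IsSplitting q p ∧
      leakageReal b (Function.uncurry (compose q W)) = sibsonForm b p' W := by
  have hb0 : 0 < b := by linarith
  -- Pieces `p x * v x i` have a `b`-th power sum between `0` and `p x ^ b`, so that it can be made
  -- equal to `c * p' x` for all `x` at once if `c` is small.
  have hc : ∀ x, ∀ᶠ c in 𝓝[>] (0 : ℝ), 0 < p x → c * p' x ≤ p x ^ b := fun x => by
    rcases (hp.1 x).eq_or_lt with h | h
    · exact Eventually.of_forall fun c hc => absurd hc h.not_lt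
    · have : Tendsto (fun c : ℝ => c * p' x) (𝓝[>] 0) (𝓝 (0 * p' x)) :=
        (tendsto_id.mul_const _).mono_left nhdsWithin_le_nhds
      rw [zero_mul] at this
      filter_upwards [this.eventually_le_const (Real.rpow_pos_of_pos h b)] with c hc _
      exact hc
  obtain ⟨c, hc, hc0⟩ := ((eventually_all.2 hc).and self_mem_nhdsWithin).exists
  replace hc0 : 0 < c := hc0
  obtain ⟨n, v, hv⟩ := exists_split_sum_rpow (t := fun x =>
      if 0 < p x then c * p' x / p x ^ b else 1) hb
    (fun x => by
      split_ifs with h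
      · exact div_pos (mul_pos hc0 ((hpp' x).2 h)) (Real.rpow_pos_of_pos h b)
      · exact one_pos)
    (fun x => by
      split_ifs with h
      · exact div_le_one_of_le₀ (hc x h) (Real.rpow_nonneg h.le b)
      · exact le_rfl)
  have hkey : ∀ x, p x ^ b * ∑ i, v x i ^ b = c * p' x := fun x => by
    rw [(hv x).2]
    rcases (hp.1 x).eq_or_lt with h | h
    · have : p' x = 0 := le_antisymm (not_lt.1 fun h' => ((hpp' x).1 h').ne h) (hp'.1 x)
      simp [← h, this, Real.zero_rpow hb0.ne']
    · simp only [h, if_true]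
      rw [mul_div_cancel₀ _ (Real.rpow_pos_of_pos h b).ne']
  have hq := isSplitting_shatter hp fun x => (hv x).1
  refine ⟨n, shatter p v, hq, ?_⟩
  have h0 := compose_mem_stdSimplex hq hp hW
  have hU := nonempty_fst_of_mem h0
  have hgen : ∀ f : X → ℝ, (∀ x, 0 ≤ f x) →
      powNorm b (fun u : X × Fin n => p u.1 * v u.1 u.2 * f u.1) = c ^ (1 / b) * wNorm b p' f := by
    intro f hf
    rw [wNorm, ← Real.mul_rpow hc0.le (Finset.sum_nonneg fun x _ =>
      mul_nonneg (hp'.1 x) (Real.rpow_nonneg (hf x) b)), powNorm, Fintype.sum_prod_type,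
      Finset.mul_sum]
    congr 1
    refine Finset.sum_congr rfl fun x _ => ?_
    rw [← mul_assoc, ← hkey, Finset.mul_sum, Finset.sum_mul]
    refine Finset.sum_congr rfl fun i _ => ?_
    rw [Real.mul_rpow (mul_nonneg (hp.1 x) ((hv x).1.1 i)) (hf x),
      Real.mul_rpow (hp.1 x) ((hv x).1.1 i)]
  rw [leakageReal_eq hb h0.1, margFst_compose hW, sibsonForm]
  congr 2
  have hden : powNorm b (fun u => ∑ x, shatter p v u x) = c ^ (1 / b) := by
    have := hgen (fun _ => 1) fun _ => zero_le_one
    simpa [sum_shatter, wNorm, hp'.2] using this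
  rw [hden, div_eq_iff (Real.rpow_pos_of_pos hc0 _).ne', Finset.sum_mul]
  refine Finset.sum_congr rfl fun y _ => ?_
  simp only [Function.uncurry_apply_pair, compose_shatter]
  rw [hgen _ fun x => channels_nonneg hW x y, mul_comm]

/-- The Sibson mutual information of order `∞` is the leakage of order `∞` of a shattered input:
here the largest atom of `U` above `x` has a probability that does not depend on `x`. -/
lemma exists_leakage_top_eq_sibsonFormTop (hp : p ∈ stdSimplex ℝ X) (hW : W ∈ channels X Y) :
    ∃ (n : ℕ) (q : X × Fin n → X → ℝ), IsSplitting q p ∧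
      leakage ∞ (Function.uncurry (compose q W)) = sibsonFormTop p W := by
  have hc : ∀ x, ∀ᶠ c in 𝓝[>] (0 : ℝ), 0 < p x → c ≤ p x := fun x => by
    rcases (hp.1 x).eq_or_lt with h | h
    · exact Eventually.of_forall fun c hc => absurd hc h.not_lt
    · filter_upwards [mem_nhdsWithin_of_mem_nhds (eventually_le_nhds h)] with c hc _
      exact hc
  obtain ⟨c, hc, hc0⟩ := ((eventually_all.2 hc).and self_mem_nhdsWithin).exists
  replace hc0 : 0 < c := hc0
  obtain ⟨n, v, hv⟩ := exists_split_norm (t := fun x => if 0 < p x then c / p x else 1)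
    (fun x => by
      split_ifs with h
      · exact div_pos hc0 h
      · exact one_pos)
    (fun x => by
      split_ifs with h
      · exact div_le_one_of_le₀ (hc x h) h.le
      · exact le_rfl)
  have hq := isSplitting_shatter hp fun x => (hv x).1
  refine ⟨n, shatter p v, hq, ?_⟩
  have h0 := compose_mem_stdSimplex hq hp hW
  have hgen : ∀ f : X → ℝ, (∀ x, 0 ≤ f x) →
      supOn (fun _ => 1) (fun u : X × Fin n => p u.1 * v u.1 u.2 * f u.1) = c * supOn p f := by
    intro f hf
    apply le_antisymm
    · refine supOn_le (mul_nonneg hc0.le (supOn_nonneg hf)) fun u _ => ?_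
      rcases (hp.1 u.1).eq_or_lt with h | h
      · rw [← h, zero_mul, zero_mul]
        exact mul_nonneg hc0.le (supOn_nonneg hf)
      · refine mul_le_mul ?_ (le_supOn p f h) (hf _) hc0.le
        have h1 : v u.1 u.2 ≤ c / p u.1 := by
          have := (hv u.1).2
          simp only [h, if_true] at this
          rw [← this]
          exact (le_abs_self _).trans (norm_le_pi_norm (v u.1) u.2)
        rwa [le_div_iff₀' h] at h1
    · rcases (supOn_nonneg (w := p) hf).eq_or_lt with hz | hz
      · rw [← hz, mul_zero]
        exact supOn_nonneg fun u =>
          mul_nonneg (mul_nonneg (hp.1 _) ((hv _).1.1 _)) (hf _)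
      · obtain ⟨x, hx, hxf⟩ := exists_eq_supOn hz
        have hnorm := (hv x).2
        simp only [hx, if_true] at hnorm
        have hle : ‖v x‖ ≤ supOn (fun _ => 1)
            (fun u : X × Fin n => p u.1 * v u.1 u.2 * f u.1) / (p x * f x) := by
          have hpf : 0 < p x * f x := mul_pos hx (hxf ▸ hz)
          rw [pi_norm_le_iff_of_nonneg (div_nonneg (supOn_nonneg fun u =>
            mul_nonneg (mul_nonneg (hp.1 _) ((hv _).1.1 _)) (hf _)) hpf.le)]
          intro i
          rw [Real.norm_of_nonneg ((hv x).1.1 i), le_div_iff₀ hpf]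
          refine le_trans (le_of_eq ?_) (le_supOn (fun _ => 1)
            (fun u : X × Fin n => p u.1 * v u.1 u.2 * f u.1) (x := (x, i)) one_pos)
          ring
        rw [hnorm, le_div_iff₀ (mul_pos hx (hxf ▸ hz)), ← mul_assoc,
          div_mul_cancel₀ _ hx.ne', hxf] at hle
        exact hle
  have hone : supOn p (fun _ => 1) = 1 := by
    obtain ⟨x, hx⟩ := exists_pos_of_mem_stdSimplex hp
    exact le_antisymm (supOn_le zero_le_one fun _ _ => le_rfl) (le_supOn p (fun _ => 1) hx)
  rw [leakage_top h0, margFst_compose hW, sibsonFormTop]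
  congr 1
  have hden : supOn (fun _ => 1) (fun u => ∑ x, shatter p v u x) = c := by
    have := hgen (fun _ => 1) fun _ => zero_le_one
    simpa [sum_shatter, hone] using this
  rw [hden, div_eq_iff hc0.ne', Finset.sum_mul]
  refine Finset.sum_congr rfl fun y _ => ?_
  simp only [Function.uncurry_apply_pair, compose_shatter]
  rw [hgen _ fun x => channels_nonneg hW x y, mul_comm]

end Interpolation

end

/-! ### The Sibson mutual information in closed form -/

noncomputable section

section Sibson

variable {X Y : Type*} [Fintype X] [Fintype Y] {p : X → ℝ} {W : X → Y → ℝ} {a : ℝ} {α : ℝ≥0∞}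

lemma sum_ofReal_mul_rpow {A q : Y → ℝ} (hA : ∀ y, 0 ≤ A y) (hq : ∀ y, 0 ≤ q y)
    (h : ∀ y, q y = 0 → A y = 0) (a : ℝ) :
    ∑ y, ENNReal.ofReal (A y) * ENNReal.ofReal (q y) ^ (1 - a) =
      ENNReal.ofReal (∑ y, A y * q y ^ (1 - a)) := by
  rw [ENNReal.ofReal_sum_of_nonneg fun y _ => mul_nonneg (hA y) (Real.rpow_nonneg (hq y) _)]
  refine Finset.sum_congr rfl fun y _ => ?_
  rcases (hq y).eq_or_lt with hy | hy
  · simp [h y hy.symm]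
  · rw [ENNReal.ofReal_rpow_of_pos hy, ENNReal.ofReal_mul (hA y)]

/-- Hölder's inequality behind the closed form of the Sibson mutual information. -/
lemma ofReal_rpow_le_sum (ha : 1 < a) {A q : Y → ℝ} (hA : ∀ y, 0 ≤ A y)
    (hq : q ∈ stdSimplex ℝ Y) :
    ENNReal.ofReal ((∑ y, A y ^ (1 / a)) ^ a) ≤
      ∑ y, ENNReal.ofReal (A y) * ENNReal.ofReal (q y) ^ (1 - a) := by
  have ha0 : 0 < a := by linarith
  -- If `q y = 0 < A y` for some `y`, the right-hand side is infinite.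
  by_cases h : ∀ y, q y = 0 → A y = 0
  · rw [sum_ofReal_mul_rpow hA hq.1 h]
    refine ENNReal.ofReal_le_ofReal ?_
    have hB : ∀ y, 0 ≤ A y * q y ^ (1 - a) := fun y =>
      mul_nonneg (hA y) (Real.rpow_nonneg (hq.1 y) _)
    have hm : 0 < (a - 1) / a := div_pos (by linarith) ha0
    have h1 := sum_rpow_mul_rpow_le Finset.univ hB hq.1 (l := 1 / a) (m := (a - 1) / a)
      (by positivity) hm (by field_simp; ring)
    have h2 : ∀ y, (A y * q y ^ (1 - a)) ^ (1 / a) * q y ^ ((a - 1) / a) = A y ^ (1 / a) := by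
      intro y
      rcases (hq.1 y).eq_or_lt with hy | hy
      · simp [← hy, h y hy.symm, Real.zero_rpow hm.ne', Real.zero_rpow (inv_pos.2 ha0).ne']
      · rw [Real.mul_rpow (hA y) (Real.rpow_nonneg hy.le _), ← Real.rpow_mul hy.le, mul_assoc,
          ← Real.rpow_add hy, show (1 - a) * (1 / a) + (a - 1) / a = 0 by ring, Real.rpow_zero,
          mul_one]
    simp only [h2, hq.2, Real.one_rpow, mul_one] at h1
    refine (Real.rpow_le_rpow (Finset.sum_nonneg fun y _ => Real.rpow_nonneg (hA y) _) h1
      ha0.le).trans_eq ?_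
    rw [← Real.rpow_mul (Finset.sum_nonneg fun y _ => hB y), one_div_mul_cancel ha0.ne',
      Real.rpow_one]
  · push Not at h
    obtain ⟨y, hy, hAy⟩ := h
    have htop : ENNReal.ofReal (A y) * ENNReal.ofReal (q y) ^ (1 - a) = ⊤ := by
      rw [hy, ENNReal.ofReal_zero, ENNReal.zero_rpow_of_neg (by linarith),
        ENNReal.mul_top (ENNReal.ofReal_pos.2 ((hA y).lt_of_ne' hAy)).ne']
    refine le_top.trans (htop.symm.le.trans ?_)
    exact Finset.single_le_sum
      (f := fun y => ENNReal.ofReal (A y) * ENNReal.ofReal (q y) ^ (1 - a))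
      (fun y _ => zero_le) (Finset.mem_univ y)

/-- Equality in Hölder's inequality holds for `q` proportional to `A ^ (1 / a)`. -/
lemma exists_sum_eq_ofReal_rpow (ha : 1 < a) {A : Y → ℝ} (hA : ∀ y, 0 ≤ A y)
    (hS : 0 < ∑ y, A y ^ (1 / a)) :
    ∃ q ∈ stdSimplex ℝ Y, ∑ y, ENNReal.ofReal (A y) * ENNReal.ofReal (q y) ^ (1 - a) =
      ENNReal.ofReal ((∑ y, A y ^ (1 / a)) ^ a) := by
  have ha0 : 0 < a := by linarith
  have hq0 : ∀ y, 0 ≤ A y ^ (1 / a) := fun y => Real.rpow_nonneg (hA y) _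
  set S := ∑ y, A y ^ (1 / a) with hSdef
  refine ⟨fun y => A y ^ (1 / a) / S, ⟨fun y => div_nonneg (hq0 y) hS.le, ?_⟩, ?_⟩
  · rw [← Finset.sum_div, div_self hS.ne']
  · rw [sum_ofReal_mul_rpow hA (fun y => div_nonneg (hq0 y) hS.le)]
    · congr 1
      have h1 : ∀ y, A y * (A y ^ (1 / a) / S) ^ (1 - a) = A y ^ (1 / a) * S ^ (a - 1) := by
        intro y
        rcases (hA y).eq_or_lt with hy | hy
        · simp [← hy, Real.zero_rpow (inv_pos.2 ha0).ne']
        · rw [Real.div_rpow (hq0 y) hS.le, ← Real.rpow_mul hy.le, ← mul_div_assoc,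
            ← Real.rpow_one_add' hy.le (by field_simp; simp [ha0.ne']), div_eq_mul_inv,
            ← Real.rpow_neg hS.le]
          congr 2
          · field_simp; ring
          · ring
      simp only [h1]
      rw [← Finset.sum_mul, ← hSdef, ← Real.rpow_one_add' hS.le (by linarith)]
      ring_nf
    · intro y hy
      by_contra hne
      exact (div_pos (Real.rpow_pos_of_pos ((hA y).lt_of_ne' hne) _) hS).ne' hy

lemma renyiDiv_jointLaw (ha : 1 < a) (hp : ∀ x, 0 ≤ p x) (hW : W ∈ channels X Y) (q : Y → ℝ) :
    renyiDiv a (jointLaw p W) (fun z => margFst (jointLaw p W) z.1 * q z.2) =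
      (((a - 1)⁻¹ : ℝ) : EReal) * ENNReal.log
        (∑ y, ENNReal.ofReal (∑ x, p x * W x y ^ a) * ENNReal.ofReal (q y) ^ (1 - a)) := by
  have ha0 : 0 < a := by linarith
  rw [renyiDiv, margFst_jointLaw hW, Fintype.sum_prod_type_right]
  congr 2
  refine Finset.sum_congr rfl fun y _ => ?_
  rw [ENNReal.ofReal_sum_of_nonneg fun x _ =>
    mul_nonneg (hp x) (Real.rpow_nonneg (channels_nonneg hW x y) _), Finset.sum_mul]
  refine Finset.sum_congr rfl fun x _ => ?_
  simp only [jointLaw]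
  rcases (hp x).eq_or_lt with hx | hx
  · simp [← hx, ENNReal.zero_rpow_of_pos ha0]
  · rw [ENNReal.ofReal_mul hx.le, ENNReal.ofReal_mul hx.le, ENNReal.ofReal_mul hx.le,
      ENNReal.mul_rpow_of_ne_top ENNReal.ofReal_ne_top ENNReal.ofReal_ne_top,
      ENNReal.mul_rpow_of_ne_top ENNReal.ofReal_ne_top ENNReal.ofReal_ne_top,
      mul_mul_mul_comm, ← ENNReal.rpow_add _ _ (ENNReal.ofReal_pos.2 hx).ne' ENNReal.ofReal_ne_top,
      add_sub_cancel, ENNReal.rpow_one,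
      ENNReal.ofReal_rpow_of_nonneg (channels_nonneg hW x y) ha0.le, mul_assoc]

lemma sibsonMIReal_jointLaw (ha : 1 < a) (hp : p ∈ stdSimplex ℝ X) (hW : W ∈ channels X Y) :
    sibsonMIReal a (jointLaw p W) = (sibsonForm a p W : ℝ) := by
  have ha1 : 0 < (a - 1)⁻¹ := inv_pos.2 (by linarith)
  have hA : ∀ y, 0 ≤ ∑ x, p x * W x y ^ a := fun y => Finset.sum_nonneg fun x _ =>
    mul_nonneg (hp.1 x) (Real.rpow_nonneg (channels_nonneg hW x y) _)
  have hS : 0 < ∑ y, (∑ x, p x * W x y ^ a) ^ (1 / a) := sum_wNorm_pos hp hW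
  have hval : (((a - 1)⁻¹ : ℝ) : EReal) * ENNReal.log (ENNReal.ofReal
      ((∑ y, (∑ x, p x * W x y ^ a) ^ (1 / a)) ^ a)) = (sibsonForm a p W : ℝ) := by
    rw [ENNReal.log_ofReal_of_pos (Real.rpow_pos_of_pos hS _), ← EReal.coe_mul, Real.log_rpow hS,
      sibsonForm]
    simp only [wNorm]
    congr 1
    ring
  unfold sibsonMIReal
  apply le_antisymm
  · obtain ⟨q, hq, he⟩ := exists_sum_eq_ofReal_rpow ha hA hS
    refine iInf₂_le_of_le q hq ?_
    rw [renyiDiv_jointLaw ha hp.1 hW, he, hval]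
  · refine le_iInf₂ fun q hq => ?_
    rw [renyiDiv_jointLaw ha hp.1 hW, ← hval]
    exact mul_le_mul_of_nonneg_left (ENNReal.log_monotone (ofReal_rpow_le_sum ha hA hq))
      (EReal.coe_nonneg.2 ha1.le)

lemma sibsonMI_of_ne (h1 : 1 < α) (h2 : α ≠ ∞) (hp : p ∈ stdSimplex ℝ X)
    (hW : W ∈ channels X Y) :
    sibsonMI α (jointLaw p W) = (sibsonForm α.toReal p W : ℝ) := by
  rw [sibsonMI, if_neg h1.ne', if_neg h2, sibsonMIReal_jointLaw (one_lt_toReal h1 h2) hp hW]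

lemma sibsonMI_top (hp : p ∈ stdSimplex ℝ X) (hW : W ∈ channels X Y) :
    sibsonMI ∞ (jointLaw p W) = (sibsonFormTop p W : ℝ) := by
  rw [sibsonMI, if_neg ENNReal.top_ne_one, if_pos rfl]
  refine Tendsto.limUnder_eq ?_
  refine ((continuous_coe_real_ereal.tendsto _).comp (tendsto_sibsonForm_atTop hp hW)).congr' ?_
  filter_upwards [eventually_gt_atTop 1] with a ha
  exact (sibsonMIReal_jointLaw ha hp hW).symm

lemma renyiDiv_nonneg_of_lt_one {ι : Type*} [Fintype ι] (ha : 0 < a) (ha1 : a < 1) {P Q : ι → ℝ}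
    (hP : P ∈ stdSimplex ℝ ι) (hQ : Q ∈ stdSimplex ℝ ι) : 0 ≤ renyiDiv a P Q := by
  have h : ∑ i, ENNReal.ofReal (P i) ^ a * ENNReal.ofReal (Q i) ^ (1 - a) ≤ 1 := by
    have h1 := sum_rpow_mul_rpow_le Finset.univ hP.1 hQ.1 ha (sub_pos.2 ha1) (by ring)
    rw [hP.2, hQ.2, Real.one_rpow, Real.one_rpow, one_mul] at h1
    rw [← ENNReal.ofReal_one]
    refine le_trans (le_of_eq ?_) (ENNReal.ofReal_le_ofReal h1)
    rw [ENNReal.ofReal_sum_of_nonneg fun i _ =>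
      mul_nonneg (Real.rpow_nonneg (hP.1 i) _) (Real.rpow_nonneg (hQ.1 i) _)]
    refine Finset.sum_congr rfl fun i _ => ?_
    rw [ENNReal.ofReal_mul (Real.rpow_nonneg (hP.1 i) _),
      ENNReal.ofReal_rpow_of_nonneg (hP.1 i) ha.le,
      ENNReal.ofReal_rpow_of_nonneg (hQ.1 i) (sub_pos.2 ha1).le]
  unfold renyiDiv
  have h2 : 0 ≤ (((-(a - 1)⁻¹ : ℝ)) : EReal) :=
    EReal.coe_nonneg.2 (neg_nonneg.2 (inv_nonpos.2 (by linarith)))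
  have h3 := mul_nonneg h2 (EReal.neg_nonneg.2 (ENNReal.log_le_zero_iff.2 h))
  rwa [EReal.coe_neg, neg_mul_neg] at h3

lemma renyiDiv_self {ι : Type*} [Fintype ι] (ha : 0 < a) {P : ι → ℝ}
    (hP : P ∈ stdSimplex ℝ ι) : renyiDiv a P P = 0 := by
  have h : ∀ i, ENNReal.ofReal (P i) ^ a * ENNReal.ofReal (P i) ^ (1 - a) =
      ENNReal.ofReal (P i) := by
    intro i
    rcases (hP.1 i).eq_or_lt with hi | hi
    · simp [← hi, ENNReal.zero_rpow_of_pos ha]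
    · rw [← ENNReal.rpow_add _ _ (ENNReal.ofReal_pos.2 hi).ne' ENNReal.ofReal_ne_top,
        add_sub_cancel, ENNReal.rpow_one]
  rw [renyiDiv]
  simp only [h]
  rw [← ENNReal.ofReal_sum_of_nonneg fun i _ => hP.1 i, hP.2, ENNReal.ofReal_one,
    ENNReal.log_one, mul_zero]

lemma product_mem_stdSimplex {q : Y → ℝ} (hp : p ∈ stdSimplex ℝ X) (hq : q ∈ stdSimplex ℝ Y) :
    (fun z : X × Y => p z.1 * q z.2) ∈ stdSimplex ℝ (X × Y) :=
  jointLaw_mem_stdSimplex (W := fun _ => q) hp fun _ => hq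

lemma sibsonForm_const {r : Y → ℝ} (ha : 1 < a) (hp : p ∈ stdSimplex ℝ X)
    (hr : r ∈ stdSimplex ℝ Y) : sibsonForm a p (fun _ => r) = 0 := by
  have ha0 : a ≠ 0 := by linarith
  simp only [sibsonForm, wNorm, ← Finset.sum_mul, hp.2, one_mul]
  simp only [← Real.rpow_mul (hr.1 _), mul_one_div_cancel ha0, Real.rpow_one, hr.2, Real.log_one,
    mul_zero]

lemma sibsonFormTop_const {r : Y → ℝ} (hp : p ∈ stdSimplex ℝ X) (hr : r ∈ stdSimplex ℝ Y) :
    sibsonFormTop p (fun _ => r) = 0 := by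
  obtain ⟨x, hx⟩ := exists_pos_of_mem_stdSimplex hp
  have : ∀ y, supOn p (fun _ => r y) = r y := fun y =>
    le_antisymm (supOn_le (hr.1 y) fun _ _ => le_rfl) (le_supOn p (fun _ => r y) hx)
  simp only [sibsonFormTop, this, hr.2, Real.log_one]

/-- The Sibson mutual information of every order `α ∈ [1, ∞]` vanishes under independence. At the
order `1` the defining limit is two-sided, so the orders below `1` matter as well. -/
lemma sibsonMI_const {r : Y → ℝ} (hα : 1 ≤ α) (hp : p ∈ stdSimplex ℝ X)
    (hr : r ∈ stdSimplex ℝ Y) : sibsonMI α (jointLaw p (fun _ => r)) = 0 := by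
  have hW : (fun _ => r) ∈ channels X Y := fun _ => hr
  rcases hα.eq_or_lt with rfl | h1
  · rw [sibsonMI, if_pos rfl]
    refine Tendsto.limUnder_eq (tendsto_const_nhds.congr' ?_)
    filter_upwards [self_mem_nhdsWithin,
      mem_nhdsWithin_of_mem_nhds (eventually_gt_nhds (zero_lt_one' ℝ))] with a hne ha
    rcases lt_or_gt_of_ne hne with h | h
    · unfold sibsonMIReal
      rw [margFst_jointLaw hW]
      apply le_antisymm
      · exact le_iInf₂ fun q hq => renyiDiv_nonneg_of_lt_one ha h
          (jointLaw_mem_stdSimplex hp hW) (product_mem_stdSimplex hp hq)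
      · exact iInf₂_le_of_le r hr (renyiDiv_self ha (product_mem_stdSimplex hp hr)).le
    · rw [sibsonMIReal_jointLaw h hp hW, sibsonForm_const h hp hr, EReal.coe_zero]
  · by_cases h2 : α = ∞
    · rw [h2, sibsonMI_top hp hW, sibsonFormTop_const hp hr, EReal.coe_zero]
    · rw [sibsonMI_of_ne h1 h2 hp hW, sibsonForm_const (one_lt_toReal h1 h2) hp hr,
        EReal.coe_zero]

end Sibson

end

/-! ### Properties of the maximal leakage -/

section Properties

variable {X Y : Type*} [Fintype X] [Fintype Y] {p : X → ℝ} {W : X → Y → ℝ} {a : ℝ}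
  {α β : ℝ≥0∞} {P : X × Y → ℝ}

lemma supOn_congr {w w' f : X → ℝ} (h : ∀ x, 0 < w x ↔ 0 < w' x) : supOn w f = supOn w' f := by
  simp only [supOn, h]

lemma maxLeakage_le_sibsonFormTop (hα : 1 ≤ α) (hp : p ∈ stdSimplex ℝ X)
    (hW : W ∈ channels X Y) :
    maxLeakage α (jointLaw p W) ≤ (sibsonFormTop p W : ℝ) := by
  refine maxLeakage_jointLaw_le hW fun n q hq => EReal.coe_le_coe_iff.2 ?_
  refine le_of_tendsto (tendsto_leakage α (compose_mem_stdSimplex hq hp hW)) ?_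
  filter_upwards [eventually_one_lt hα] with a ha
  obtain ⟨p', hp', hpp', hle⟩ := exists_leakageReal_compose_le_sibsonForm ha hq hp hW
  refine hle.trans ((sibsonForm_le_top hp' hW ha).trans_eq ?_)
  simp only [sibsonFormTop, supOn_congr hpp']

lemma maxLeakage_top (hp : p ∈ stdSimplex ℝ X) (hW : W ∈ channels X Y) :
    maxLeakage ∞ (jointLaw p W) = (sibsonFormTop p W : ℝ) := by
  obtain ⟨n, q, hq, he⟩ := exists_leakage_top_eq_sibsonFormTop hp hW
  refine le_antisymm (maxLeakage_le_sibsonFormTop le_top hp hW) ?_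
  rw [← he]
  exact leakage_le_maxLeakage le_top hp hW hq

lemma sibsonForm_le_maxLeakage (h1 : 1 < α) (h2 : α ≠ ∞) (hp : p ∈ stdSimplex ℝ X)
    (hW : W ∈ channels X Y) {p' : X → ℝ} (hp' : p' ∈ stdSimplex ℝ X)
    (hpp' : ∀ x, 0 < p' x ↔ 0 < p x) :
    ((sibsonForm α.toReal p' W : ℝ) : EReal) ≤ maxLeakage α (jointLaw p W) := by
  obtain ⟨n, q, hq, he⟩ :=
    exists_leakageReal_eq_sibsonForm (one_lt_toReal h1 h2) hp hW hp' hpp'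
  rw [← he, ← leakage_of_ne h1 h2]
  exact leakage_le_maxLeakage h1.le hp hW hq

lemma maxLeakage_mono (hα : 1 ≤ α) (hαβ : α ≤ β) (hP : P ∈ stdSimplex ℝ (X × Y)) :
    maxLeakage α P ≤ maxLeakage β P := by
  obtain ⟨W, hW, hPW⟩ := exists_channel hP
  have hp := margFst_mem hP
  rw [hPW]
  by_cases hβ : β = ∞
  · rw [hβ, maxLeakage_top hp hW]
    exact maxLeakage_le_sibsonFormTop hα hp hW
  rcases (hα.trans hαβ).eq_or_lt with h | hβ1
  · rw [le_antisymm hαβ (h ▸ hα)]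
  refine maxLeakage_jointLaw_le hW fun n q hq => ?_
  refine le_of_tendsto ((continuous_coe_real_ereal.tendsto _).comp
    (tendsto_leakage α (compose_mem_stdSimplex hq hp hW))) ?_
  filter_upwards [eventually_one_lt hα, eventually_le_toReal hαβ hβ1 hβ] with a ha hab
  obtain ⟨p', hp', hpp', hle⟩ := exists_leakageReal_compose_le_sibsonForm ha hq hp hW
  exact (EReal.coe_le_coe_iff.2 (hle.trans (sibsonForm_mono hp' hW ha hab))).trans
    (sibsonForm_le_maxLeakage hβ1 hβ hp hW hp' hpp')

/-- The choice `U = X` in the definition of the maximal leakage. -/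
lemma leakage_self_le_maxLeakage (hα : 1 ≤ α) (hP : P ∈ stdSimplex ℝ (X × Y)) :
    ((leakage α P : ℝ) : EReal) ≤ maxLeakage α P := by
  classical
  obtain ⟨W, hW, hPW⟩ := exists_channel hP
  have hp := margFst_mem hP
  have hq : IsSplitting (fun u x => if u = x then margFst P x else 0) (margFst P) :=
    ⟨fun u x => by dsimp only; split_ifs <;> simp [hp.1 x], fun x => by simp⟩
  have h := leakage_le_maxLeakage hα hp hW hq
  rw [← hPW] at h
  convert h using 3
  rw [hPW]
  funext ⟨u, y⟩
  simp [compose, jointLaw, margFst_jointLaw hW]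

lemma maxLeakage_nonneg (hα : 1 ≤ α) (hP : P ∈ stdSimplex ℝ (X × Y)) : 0 ≤ maxLeakage α P :=
  (EReal.coe_nonneg.2 (leakage_nonneg hα hP)).trans (leakage_self_le_maxLeakage hα hP)

/-- Gibbs' inequality for two numbers, with its equality case. -/
lemma eq_of_mul_log_sub_le {s t : ℝ} (hs : 0 ≤ s) (ht : 0 ≤ t) (hst : t = 0 → s = 0) :
    0 ≤ s * Real.log s - s * Real.log t - s + t ∧
      (s * Real.log s - s * Real.log t - s + t = 0 → s = t) := by
  rcases hs.eq_or_lt with rfl | hs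
  · simp [ht, eq_comm]
  have ht : 0 < t := ht.lt_of_ne' fun h => hs.ne' (hst h)
  have hlog : Real.log (t / s) = Real.log t - Real.log s := Real.log_div ht.ne' hs.ne'
  by_cases h : t / s = 1
  · rw [div_eq_one_iff_eq hs.ne'] at h
    subst h
    simp
  · have h1 := mul_lt_mul_of_pos_left (Real.log_lt_sub_one_of_pos (div_pos ht hs) h) hs
    rw [hlog, mul_sub, mul_sub, mul_div_cancel₀ _ hs.ne', mul_one] at h1
    exact ⟨by linarith, fun h2 => by linarith⟩

lemma isIndep_of_mutualInfo_nonpos (hP : P ∈ stdSimplex ℝ (X × Y)) (h : mutualInfo P ≤ 0) :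
    IsIndep P := by
  have hX := margFst_mem hP
  have hY := margSnd_mem hP
  have hPX : ∀ z : X × Y, margFst P z.1 = 0 → P z = 0 := fun z hz =>
    (Finset.sum_eq_zero_iff_of_nonneg fun y _ => hP.1 (z.1, y)).1 hz z.2 (Finset.mem_univ _)
  have hPY : ∀ z : X × Y, margSnd P z.2 = 0 → P z = 0 := fun z hz =>
    (Finset.sum_eq_zero_iff_of_nonneg fun x _ => hP.1 (x, z.2)).1 hz z.1 (Finset.mem_univ _)
  have hg := fun z : X × Y => eq_of_mul_log_sub_le (hP.1 z)
    (mul_nonneg (hX.1 z.1) (hY.1 z.2)) fun hz =>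
      (mul_eq_zero.1 hz).elim (hPX z) (hPY z)
  have hsum : ∑ z : X × Y, (P z * Real.log (P z) -
      P z * Real.log (margFst P z.1 * margSnd P z.2) - P z + margFst P z.1 * margSnd P z.2) =
      mutualInfo P := by
    have h1 : ∀ z : X × Y, P z * Real.log (margFst P z.1 * margSnd P z.2) =
        P z * Real.log (margFst P z.1) + P z * Real.log (margSnd P z.2) := fun z => by
      by_cases hz : P z = 0
      · simp [hz]
      · rw [Real.log_mul (fun h => hz (hPX z h)) (fun h => hz (hPY z h)), mul_add]
    have h2 : ∑ z : X × Y, P z * Real.log (margFst P z.1) = -shannonEntropy (margFst P) := by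
      rw [Fintype.sum_prod_type, shannonEntropy, ← Finset.sum_neg_distrib]
      refine Finset.sum_congr rfl fun x _ => ?_
      simp only [← Finset.sum_mul, Real.negMulLog, neg_mul, neg_neg, margFst]
    have h3 : ∑ z : X × Y, P z * Real.log (margSnd P z.2) = -shannonEntropy (margSnd P) := by
      rw [Fintype.sum_prod_type_right, shannonEntropy, ← Finset.sum_neg_distrib]
      refine Finset.sum_congr rfl fun y _ => ?_
      simp only [← Finset.sum_mul, Real.negMulLog, neg_mul, neg_neg, margSnd]
    have h4 : ∑ z : X × Y, P z * Real.log (P z) = -shannonEntropy P := by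
      simp [shannonEntropy, Real.negMulLog]
    have h5 : ∑ z : X × Y, margFst P z.1 * margSnd P z.2 = 1 :=
      (product_mem_stdSimplex hX hY).2
    simp only [h1, Finset.sum_add_distrib, Finset.sum_sub_distrib, h2, h3, h4, h5, hP.2,
      mutualInfo]
    ring
  have hzero := (Finset.sum_eq_zero_iff_of_nonneg fun z _ => (hg z).1).1
    (le_antisymm (hsum.trans_le h) (Finset.sum_nonneg fun z _ => (hg z).1))
  exact fun x y => (hg (x, y)).2 (hzero (x, y) (Finset.mem_univ _))

lemma IsIndep.eq_jointLaw (h : IsIndep P) :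
    P = jointLaw (margFst P) (fun _ => margSnd P) :=
  funext fun z => h z.1 z.2

lemma maxLeakage_eq_zero_iff (hα : 1 ≤ α) (hP : P ∈ stdSimplex ℝ (X × Y)) :
    maxLeakage α P = 0 ↔ IsIndep P := by
  constructor
  · intro h
    refine isIndep_of_mutualInfo_nonpos hP ?_
    -- The leakage of order `1` from `X` itself is the mutual information.
    have h1 := (leakage_self_le_maxLeakage le_rfl hP).trans (maxLeakage_mono le_rfl hα hP)
    rw [h, leakage_one hP] at h1
    exact EReal.coe_nonpos.1 h1
  · intro h
    refine le_antisymm ?_ (maxLeakage_nonneg hα hP)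
    have h1 := maxLeakage_le_sibsonFormTop hα (margFst_mem hP)
      (W := fun _ => margSnd P) (fun _ => margSnd_mem hP)
    rwa [← h.eq_jointLaw, sibsonFormTop_const (margFst_mem hP) (margSnd_mem hP),
      EReal.coe_zero] at h1

lemma sibsonFormTop_le_log_card (hp : p ∈ stdSimplex ℝ X) (hW : W ∈ channels X Y) :
    sibsonFormTop p W ≤ Real.log (Fintype.card X) := by
  refine Real.log_le_log (sum_supOn_pos hp hW) ?_
  calc ∑ y, supOn p (fun x => W x y) ≤ ∑ y, ∑ x, W x y := by
        refine Finset.sum_le_sum fun y _ => ?_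
        exact supOn_le (Finset.sum_nonneg fun x _ => channels_nonneg hW x y) fun x _ =>
          Finset.single_le_sum (f := fun x => W x y) (fun x _ => channels_nonneg hW x y)
            (Finset.mem_univ x)
    _ = Fintype.card X := by
        rw [Finset.sum_comm]
        simp [(hW _).2]

lemma negMulLog_sum_le {f : X → ℝ} (hf : ∀ x, 0 ≤ f x) :
    Real.negMulLog (∑ x, f x) ≤ ∑ x, Real.negMulLog (f x) := by
  simp only [Real.negMulLog, neg_mul, Finset.sum_neg_distrib, Finset.sum_mul]
  refine neg_le_neg (Finset.sum_le_sum fun x _ => ?_)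
  rcases (hf x).eq_or_lt with h | h
  · simp [← h]
  · exact mul_le_mul_of_nonneg_left (Real.log_le_log h
      (Finset.single_le_sum (fun x _ => hf x) (Finset.mem_univ x))) h.le

lemma mutualInfo_le_shannonEntropy_margSnd (hP : P ∈ stdSimplex ℝ (X × Y)) :
    mutualInfo P ≤ shannonEntropy (margSnd P) := by
  have h : shannonEntropy (margFst P) ≤ shannonEntropy P := by
    simp only [shannonEntropy]
    rw [Fintype.sum_prod_type]
    exact Finset.sum_le_sum fun x _ => negMulLog_sum_le fun y => hP.1 (x, y)
  unfold mutualInfo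
  linarith

/-- By data processing, the mutual information `I(U; Y)` is at most `I(U; X)`. -/
lemma maxLeakage_one_le_shannonEntropy (hP : P ∈ stdSimplex ℝ (X × Y)) :
    maxLeakage 1 P ≤ (shannonEntropy (margFst P) : ℝ) := by
  obtain ⟨W, hW, hPW⟩ := exists_channel hP
  have hp := margFst_mem hP
  set p := margFst P
  rw [hPW]
  refine maxLeakage_jointLaw_le hW fun n q hq => EReal.coe_le_coe_iff.2 ?_
  refine (leakage_compose_le le_rfl hq hp hW).trans ?_
  have hq' := uncurry_mem_stdSimplex hq hp
  rw [leakage_one hq']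
  refine (mutualInfo_le_shannonEntropy_margSnd hq').trans_eq ?_
  congr 1
  exact funext hq.2

lemma mutualInfo_of_isFunctionOfSnd (h : IsFunctionOfSnd P) :
    mutualInfo P = shannonEntropy (margFst P) := by
  obtain ⟨g, hg⟩ := h
  have hz : ∀ y x, x ≠ g y → P (x, y) = 0 := fun y x hx => by
    by_contra hne
    exact hx (hg x y hne)
  have h1 : shannonEntropy (margSnd P) = shannonEntropy P := by
    simp only [shannonEntropy]
    rw [Fintype.sum_prod_type_right]
    refine Finset.sum_congr rfl fun y _ => ?_
    rw [Fintype.sum_eq_single (g y) fun x hx => by rw [hz y x hx, Real.negMulLog_zero], margSnd,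
      Fintype.sum_eq_single (g y) fun x hx => hz y x hx]
  rw [mutualInfo, h1, add_sub_cancel_right]

lemma maxLeakage_one_of_isFunctionOfSnd (hP : P ∈ stdSimplex ℝ (X × Y)) (h : IsFunctionOfSnd P) :
    maxLeakage 1 P = (shannonEntropy (margFst P) : ℝ) := by
  refine le_antisymm (maxLeakage_one_le_shannonEntropy hP) ?_
  rw [← mutualInfo_of_isFunctionOfSnd h, ← leakage_one hP]
  exact leakage_self_le_maxLeakage le_rfl hP

lemma uniformLaw_mem [Nonempty X] : uniformLaw X ∈ stdSimplex ℝ X :=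
  ⟨fun _ => by unfold uniformLaw; positivity, by simp [uniformLaw]⟩

lemma uniformLaw_pos (x : X) : 0 < uniformLaw X x := by
  have : Nonempty X := ⟨x⟩
  unfold uniformLaw
  exact one_div_pos.2 (Nat.cast_pos.2 Fintype.card_pos)

lemma sum_wNorm_uniformLaw (hW : W ∈ channels X Y) (a : ℝ) :
    ∑ y, wNorm a (uniformLaw X) (fun x => W x y) =
      (∑ y, (∑ x, W x y ^ a) ^ (1 / a)) / (Fintype.card X : ℝ) ^ (1 / a) := by
  rw [Finset.sum_div]
  refine Finset.sum_congr rfl fun y _ => ?_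
  rw [← Real.div_rpow (sum_rpow_nonneg fun x => channels_nonneg hW x y) (Nat.cast_nonneg _),
    wNorm]
  simp only [uniformLaw, ← Finset.mul_sum]
  rw [one_div_mul_eq_div]

lemma sibsonForm_uniformLaw_of_isFunctionOfSnd (ha : 1 < a) (hp : ∀ x, 0 < p x)
    (hX : Nonempty X) (hW : W ∈ channels X Y) (h : IsFunctionOfSnd (jointLaw p W)) :
    sibsonForm a (uniformLaw X) W = Real.log (Fintype.card X) := by
  have ha0 : 0 < a := by linarith
  obtain ⟨g, hg⟩ := h
  have hz : ∀ y x, x ≠ g y → W x y = 0 := fun y x hx => by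
    by_contra hne
    exact hx (hg x y (mul_ne_zero (hp x).ne' hne))
  have hc : (0 : ℝ) < Fintype.card X := Nat.cast_pos.2 Fintype.card_pos
  have h1 : ∑ y, (∑ x, W x y ^ a) ^ (1 / a) = Fintype.card X := by
    have h2 : ∀ y, (∑ x, W x y ^ a) ^ (1 / a) = ∑ x, W x y := fun y => by
      rw [Fintype.sum_eq_single (g y) fun x hx => by rw [hz y x hx, Real.zero_rpow ha0.ne'],
        Fintype.sum_eq_single (g y) fun x hx => hz y x hx,
        ← Real.rpow_mul (channels_nonneg hW _ _), mul_one_div_cancel ha0.ne', Real.rpow_one]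
    simp only [h2]
    rw [Finset.sum_comm]
    simp [(hW _).2]
  rw [sibsonForm, sum_wNorm_uniformLaw hW, h1, Real.log_div hc.ne'
    (Real.rpow_pos_of_pos hc _).ne', Real.log_rpow hc]
  have : a - 1 ≠ 0 := by linarith
  field_simp

lemma maxLeakage_of_isFunctionOfSnd (hα : 1 < α) (hP : P ∈ stdSimplex ℝ (X × Y))
    (hpos : ∀ x, 0 < margFst P x) (h : IsFunctionOfSnd P) :
    maxLeakage α P = (Real.log (Fintype.card X) : ℝ) := by
  obtain ⟨W, hW, hPW⟩ := exists_channel hP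
  have hX := nonempty_fst_of_mem hP
  have hp := margFst_mem hP
  -- The order `∞` follows from the order `2` by monotonicity.
  have key : ∀ β : ℝ≥0∞, 1 < β → β ≠ ∞ →
      ((Real.log (Fintype.card X) : ℝ) : EReal) ≤ maxLeakage β P := by
    intro β h1 h2
    rw [← sibsonForm_uniformLaw_of_isFunctionOfSnd (one_lt_toReal h1 h2) hpos hX hW (hPW ▸ h)]
    rw [hPW]
    exact sibsonForm_le_maxLeakage h1 h2 hp hW uniformLaw_mem
      fun x => iff_of_true (uniformLaw_pos x) (hpos x)
  apply le_antisymm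
  · rw [hPW]
    exact (maxLeakage_le_sibsonFormTop hα.le hp hW).trans
      (EReal.coe_le_coe_iff.2 (sibsonFormTop_le_log_card hp hW))
  · by_cases h2 : α = ∞
    · exact (key 2 ENNReal.one_lt_two ENNReal.ofNat_ne_top).trans
        (maxLeakage_mono ENNReal.one_lt_two.le (h2 ▸ le_top) hP)
    · exact key α hα h2

/-- For a symmetric channel, the closed form of the Sibson mutual information is maximized by the
uniform input law: by concavity of `t ↦ t ^ (1 / a)`, the value at any input law is at most one
that depends only on the common sum of the `a`-th powers over a row, and it is attained when the
sums over the columns agree. -/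
lemma sibsonForm_le_uniformLaw (ha : 1 < a) (hp : p ∈ stdSimplex ℝ X) (hW : W ∈ channels X Y)
    (hsymm : IsSymmetricChannel W) : sibsonForm a p W ≤ sibsonForm a (uniformLaw X) W := by
  have ha0 : 0 < a := by linarith
  have hX := nonempty_of_mem_stdSimplex hp
  obtain ⟨x₀⟩ := id hX
  obtain ⟨y₀⟩ := nonempty_of_mem_stdSimplex (hW x₀)
  have hY : Nonempty Y := ⟨y₀⟩
  have hcY : (0 : ℝ) < Fintype.card Y := Nat.cast_pos.2 Fintype.card_pos
  set R := ∑ y, W x₀ y ^ a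
  have hrow : ∀ x, ∑ y, W x y ^ a = R := fun x => by
    obtain ⟨σ, hσ⟩ := hsymm.1 x₀ x
    simp only [hσ]
    exact Equiv.sum_comp σ fun y => W x₀ y ^ a
  have htot : ∀ p' ∈ stdSimplex ℝ X, ∑ y, ∑ x, p' x * W x y ^ a = R := fun p' hp' => by
    rw [Finset.sum_comm]
    simp only [← Finset.mul_sum, hrow, ← Finset.sum_mul, hp'.2, one_mul]
  set T := ∑ x, uniformLaw X x * W x y₀ ^ a
  have hcol : ∀ y, ∑ x, uniformLaw X x * W x y ^ a = T := fun y => by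
    obtain ⟨τ, hτ⟩ := hsymm.2 y₀ y
    simp only [hτ]
    exact Equiv.sum_comp τ fun x => uniformLaw X x * W x y₀ ^ a
  have hT : 0 ≤ T := Finset.sum_nonneg fun x _ => mul_nonneg (uniformLaw_pos x).le
    (Real.rpow_nonneg (channels_nonneg hW x y₀) a)
  have hRT : R = Fintype.card Y * T := by
    rw [← htot _ uniformLaw_mem]
    simp [hcol]
  refine mul_le_mul_of_nonneg_left (Real.log_le_log (sum_wNorm_pos hp hW) ?_)
    (div_nonneg ha0.le (by linarith))
  have h := sum_rpow_mul_rpow_le (Finset.univ : Finset Y) (u := fun y => ∑ x, p x * W x y ^ a)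
    (v := fun _ => 1) (fun y => Finset.sum_nonneg fun x _ => mul_nonneg (hp.1 x)
      (Real.rpow_nonneg (channels_nonneg hW x y) a)) (fun _ => zero_le_one)
    (l := 1 / a) (m := (a - 1) / a) (by positivity) (div_pos (by linarith) ha0)
    (by field_simp; ring)
  simp only [Real.one_rpow, mul_one, htot p hp, Finset.sum_const, Finset.card_univ,
    nsmul_eq_mul] at h
  refine h.trans_eq ?_
  simp only [wNorm, hcol, Finset.sum_const, Finset.card_univ, nsmul_eq_mul]
  rw [hRT, Real.mul_rpow hcY.le hT, mul_right_comm, ← Real.rpow_add hcY,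
    show 1 / a + (a - 1) / a = 1 by field_simp; ring, Real.rpow_one]

lemma sibsonMI_uniformLaw_le_maxLeakage (hα : 1 < α) (hp : p ∈ stdSimplex ℝ X)
    (hpos : ∀ x, 0 < p x) (hW : W ∈ channels X Y) :
    sibsonMI α (jointLaw (uniformLaw X) W) ≤ maxLeakage α (jointLaw p W) := by
  have hX := nonempty_of_mem_stdSimplex hp
  have hsupp : ∀ x, 0 < uniformLaw X x ↔ 0 < p x :=
    fun x => iff_of_true (uniformLaw_pos x) (hpos x)
  by_cases h : α = ∞
  · rw [h, sibsonMI_top uniformLaw_mem hW, maxLeakage_top hp hW]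
    simp only [sibsonFormTop, supOn_congr hsupp, le_refl]
  · rw [sibsonMI_of_ne hα h uniformLaw_mem hW]
    exact sibsonForm_le_maxLeakage hα h hp hW uniformLaw_mem hsupp

lemma maxLeakage_of_isSymmetricChannel (hα : 1 < α) (hp : p ∈ stdSimplex ℝ X)
    (hpos : ∀ x, 0 < p x) (hW : W ∈ channels X Y) (hsymm : IsSymmetricChannel W) :
    maxLeakage α (jointLaw p W) = sibsonMI α (jointLaw (uniformLaw X) W) := by
  have hX := nonempty_of_mem_stdSimplex hp
  refine le_antisymm ?_ (sibsonMI_uniformLaw_le_maxLeakage hα hp hpos hW)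
  by_cases h : α = ∞
  · rw [h, sibsonMI_top uniformLaw_mem hW, maxLeakage_top hp hW]
    simp only [sibsonFormTop, supOn_congr fun x => iff_of_true (hpos x) (uniformLaw_pos x),
      le_refl]
  · rw [sibsonMI_of_ne hα h uniformLaw_mem hW]
    refine maxLeakage_jointLaw_le hW fun n q hq => EReal.coe_le_coe_iff.2 ?_
    rw [leakage_of_ne hα h]
    obtain ⟨p', hp', -, hle⟩ :=
      exists_leakageReal_compose_le_sibsonForm (one_lt_toReal hα h) hq hp hW
    exact hle.trans (sibsonForm_le_uniformLaw (one_lt_toReal hα h) hp' hW hsymm)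

lemma maxLeakage_eq_sibsonMI_top (hα : 1 ≤ α) (hP : P ∈ stdSimplex ℝ (X × Y))
    (h : maxLeakage α P = 0 ∨ maxLeakage α P = ((Real.log (Fintype.card X) : ℝ) : EReal)) :
    maxLeakage α P = sibsonMI ∞ P := by
  rcases h with h | h
  · rw [h, ((maxLeakage_eq_zero_iff hα hP).1 h).eq_jointLaw,
      sibsonMI_const le_top (margFst_mem hP) (margSnd_mem hP)]
  · obtain ⟨W, hW, hPW⟩ := exists_channel hP
    have hp := margFst_mem hP
    set p := margFst P
    have h1 := maxLeakage_le_sibsonFormTop hα hp hW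
    rw [← hPW, h] at h1
    rw [h, hPW, sibsonMI_top hp hW]
    exact le_antisymm h1 (EReal.coe_le_coe_iff.2 (sibsonFormTop_le_log_card hp hW))

/-- Under an input law of full support, independence forces all rows of the channel to agree. -/
lemma sibsonMI_uniformLaw_of_maxLeakage_eq_zero (hα : 1 ≤ α) (hp : p ∈ stdSimplex ℝ X)
    (hpos : ∀ x, 0 < p x) (hW : W ∈ channels X Y) (h : maxLeakage α (jointLaw p W) = 0) :
    sibsonMI α (jointLaw (uniformLaw X) W) = 0 := by
  have hX := nonempty_of_mem_stdSimplex hp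
  have hP := jointLaw_mem_stdSimplex hp hW
  have hind := (maxLeakage_eq_zero_iff hα hP).1 h
  have hWc : W = fun _ => margSnd (jointLaw p W) := by
    funext x y
    have := hind x y
    rw [margFst_jointLaw hW] at this
    exact mul_left_cancel₀ (hpos x).ne' this
  have hm := margSnd_mem hP
  generalize margSnd (jointLaw p W) = m at hWc hm
  rw [hWc]
  exact sibsonMI_const hα uniformLaw_mem hm

end Properties

end MaxAlphaLeakage

open MaxAlphaLeakage
theorem theorem3 {X Y Z : Type*} [Fintype X] [Fintype Y] [Fintype Z] (α : ℝ≥0∞) (hα : 1 ≤ α) :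
    -- 1. quasi-convexity in the channel, for a fixed input distribution
    (∀ p ∈ stdSimplex ℝ X,
      QuasiconvexOn ℝ (channels X Y) (fun W => maxLeakage α (jointLaw p W))) ∧
    -- 2. monotonicity in the order
    (∀ P ∈ stdSimplex ℝ (X × Y), ∀ β : ℝ≥0∞, α ≤ β → maxLeakage α P ≤ maxLeakage β P) ∧
    -- 3. data processing inequalities
    (∀ Q ∈ stdSimplex ℝ (X × Y × Z), IsMarkovChain Q →
      maxLeakage α (fun w : X × Z => ∑ y, Q (w.1, y, w.2))
          ≤ maxLeakage α (fun w : X × Y => ∑ z, Q (w.1, w.2, z)) ∧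
      maxLeakage α (fun w : X × Z => ∑ y, Q (w.1, y, w.2))
          ≤ maxLeakage α (fun w : Y × Z => ∑ x, Q (x, w.1, w.2))) ∧
    -- 4. range
    (∀ P ∈ stdSimplex ℝ (X × Y),
      0 ≤ maxLeakage α P ∧
      (maxLeakage α P = 0 ↔ IsIndep P) ∧
      (1 < α → maxLeakage α P ≤ ((Real.log (Fintype.card X) : ℝ) : EReal)) ∧
      (α = 1 → maxLeakage α P ≤ ((shannonEntropy (margFst P) : ℝ) : EReal)) ∧
      ((∀ x, 0 < margFst P x) → IsFunctionOfSnd P →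
        (1 < α → maxLeakage α P = ((Real.log (Fintype.card X) : ℝ) : EReal)) ∧
        (α = 1 → maxLeakage α P = ((shannonEntropy (margFst P) : ℝ) : EReal)))) ∧
    -- 5. upper bound by the Sibson mutual information of order `∞`
    (∀ P ∈ stdSimplex ℝ (X × Y),
      maxLeakage α P ≤ sibsonMI ∞ P ∧
      ((maxLeakage α P = 0 ∨ maxLeakage α P = ((Real.log (Fintype.card X) : ℝ) : EReal)) →
        maxLeakage α P = sibsonMI ∞ P)) ∧
    -- 6. lower bound by the Sibson mutual information under the uniform input
    (∀ p ∈ stdSimplex ℝ X, (∀ x, 0 < p x) → ∀ W ∈ channels X Y,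
      (1 < α →
        sibsonMI α (jointLaw (uniformLaw X) W) ≤ maxLeakage α (jointLaw p W) ∧
        (α ≠ ∞ → sibsonMI α (jointLaw (uniformLaw X) W) =
          ((α.toReal / (α.toReal - 1) *
            Real.log ((∑ y, (∑ x, W x y ^ α.toReal) ^ (1 / α.toReal)) /
              (Fintype.card X : ℝ) ^ (1 / α.toReal)) : ℝ) : EReal)) ∧
        (IsSymmetricChannel W →
          maxLeakage α (jointLaw p W) = sibsonMI α (jointLaw (uniformLaw X) W))) ∧
      (maxLeakage α (jointLaw p W) = 0 →
        maxLeakage α (jointLaw p W) = sibsonMI α (jointLaw (uniformLaw X) W))) := by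
  refine ⟨fun p hp => quasiconvexOn_maxLeakage hα hp,
    fun P hP β hβ => maxLeakage_mono hα hβ hP, fun Q hQ hM => ?_,
    fun P hP => ⟨maxLeakage_nonneg hα hP, maxLeakage_eq_zero_iff hα hP, fun h1 => ?_, ?_,
      fun hpos hfun => ⟨fun h1 => maxLeakage_of_isFunctionOfSnd h1 hP hpos hfun, ?_⟩⟩,
    fun P hP => ⟨?_, maxLeakage_eq_sibsonMI_top hα hP⟩,
    fun p hp hpos W hW => ⟨fun h1 => ⟨sibsonMI_uniformLaw_le_maxLeakage h1 hp hpos hW,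
      fun h2 => ?_, maxLeakage_of_isSymmetricChannel h1 hp hpos hW⟩, fun h => ?_⟩⟩
  · obtain ⟨p, hp, W, hW, V, hV, h1, h2, h3⟩ := hM.exists_channels hQ
    rw [h1, h2, h3]
    exact ⟨maxLeakage_compose_le_left hα hp hW hV, maxLeakage_compose_le_right hα hp hW hV⟩
  · obtain ⟨W, hW, hPW⟩ := exists_channel hP
    rw [hPW]
    exact (maxLeakage_le_sibsonFormTop hα (margFst_mem hP) hW).trans
      (EReal.coe_le_coe_iff.2 (sibsonFormTop_le_log_card (margFst_mem hP) hW))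
  · rintro rfl
    exact maxLeakage_one_le_shannonEntropy hP
  · rintro rfl
    exact maxLeakage_one_of_isFunctionOfSnd hP hfun
  · obtain ⟨W, hW, hPW⟩ := exists_channel hP
    rw [hPW, sibsonMI_top (margFst_mem hP) hW]
    exact maxLeakage_le_sibsonFormTop hα (margFst_mem hP) hW
  · have hX := nonempty_of_mem_stdSimplex hp
    rw [sibsonMI_of_ne h1 h2 uniformLaw_mem hW, sibsonForm, sum_wNorm_uniformLaw hW]
  · rw [h, sibsonMI_uniformLaw_of_maxLeakage_eq_zero hα hp hpos hW h]
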